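/- For functions $\Psi,\omega:(0,\infty)\to(0,\infty)$ with $\Psi$ non-increasing and $\lim_{q\to\infty}\omega(q)=0$, let $W(\Psi)$ be the set of $x\in\mathbb R$ such that $|x-\frac pq|\le\Psi(q)$ for infinitely many $(p,q)\in\mathbb Z\times\mathbb N$ (where $\mathbb N=\{1,2,\dots\}$), and let $E(\Psi,\omega)$ be the set of $x\in W(\Psi)$ such that for all sufficiently large $q\in\mathbb N$ one has $|x-\frac pq|\ge(1-\omega(q))\Psi(q)$ for all $p\in\mathbb Z$. Let $\dim_H$ denote the Hausdorff dimension. Let $\Psi(q)=q^{-\tau_1}$ for some real $\tau_1>2$. Then the following statements are true. 1. If $\omega(q)=q^{-\tau_2}$ for some real $\tau_2$ with $0<\tau_2<\tau_1(\tau_1-2)$, then $\dim_H E(\Psi,\omega)=\frac{2}{\tau_1+\tau_2}$. 2. If $\tau_1$ is an integer, $\tau_1\ge 3$, and $\omega(q)=q^{-\tau_2}$ for some real $\tau_2$ with $0<\tau_2<\tau_1(\tau_1-1)$, then $\dim_H E(\Psi,\omega)=\frac{2}{\tau_1+\tau_2}$. 3. If $\tau_1$ is an integer, $\tau_1\ge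 3$, and $\omega(q)=Cq^{-\tau_1(\tau_1-1)}$ for some $C>\frac{45}{16}\cdot 8^{\tau_1}$, then $\dim_H E(\Psi,\omega)=\frac{2}{\tau_1^2}$. 4. If $\tau_1$ is an integer, $\tau_1\ge 3$, and $\omega(q)=cq^{-\tau_1(\tau_1-1)}$ for some $c\in(0,1)$, then $E(\Psi,\omega)=\emptyset$. -/

import Mathlib

open Filter

namespace ExactApprox

/-- The set `W(Ψ)` of `Ψ`-approximable real numbers: those `x` for which
`|x - p/q| ≤ Ψ(q)` holds for infinitely many pairs `(p, q)` with `p ∈ ℤ` and `q ≥ 1`.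
Only the values of `Ψ` at positive integers are used. -/
def wellApprox (Ψ : ℝ → ℝ) : Set ℝ :=
  {x | {pq : ℤ × ℕ | 0 < pq.2 ∧ |x - (pq.1 : ℝ) / (pq.2 : ℝ)| ≤ Ψ (pq.2 : ℝ)}.Infinite}

/-- The set `E(Ψ, ω)` of real numbers of exact `(Ψ, ω)`-order of approximation: those `x ∈ W(Ψ)`
such that for all sufficiently large `q ∈ ℕ` one has `|x - p/q| ≥ (1 - ω(q)) Ψ(q)` for every
integer `p`. -/
def exactOrder (Ψ ω : ℝ → ℝ) : Set ℝ :=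
  {x | x ∈ wellApprox Ψ ∧
    ∀ᶠ q : ℕ in atTop, ∀ p : ℤ, (1 - ω (q : ℝ)) * Ψ (q : ℝ) ≤ |x - (p : ℝ) / (q : ℝ)|}

end ExactApprox

/-! Put `σ = τ₁ + τ₂`. Up to constants, `q ^ (-σ)` is the length `ω(q) Ψ(q)` of the two windows
around `p / q` in which a point of exact order must lie for infinitely many `q`.

Upper bound: a unit interval meets `O(q)` windows of denominator `q`, so the sum of the `d`-th
powers of their lengths is controlled by `∑ q ^ (1 - σ d)`, which converges for `d > 2 / σ`
(`dimH_exactOrder_le`).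

Lower bound: a Cantor set is built from windows, kept on the right of their centres. Inside a window
around `r` of denominator `q`, denominators between `q` and a bound `B q` are excluded by hand.
Those above `B q` are treated by measure: since `τ₁ > 2`, the points too close to some `a / b` with
`b ≥ B q` fill only a small part of the window as soon as `B q ^ (-τ₁)` is negligible against `q ^
(-σ)`. By Dirichlet's theorem the remaining points lie near many rationals with denominators
comparable to a huge `N`, and the windows of these rationals are the next generation
(`eventually_exists_children`, `far_of_near_good`). As `N` is free, every `s < 2 / σ` is reached by
`le_dimH_of_cantor_scheme`; the outcome is `le_dimH_exactOrder`.

It remains to choose `B`. Repulsion from `p / q` alone allows `B q = q ^ (τ₁ - 1) / 2`, and the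
condition on `B` becomes `τ₂ < τ₁ (τ₁ - 2)`. If `τ₁ = n` is an integer, the endpoint `p / q + q ^
(-n)` is itself a rational `P / q ^ n`. Its repulsion allows a larger `B`, at the cost of trimming
`Ψ(q ^ n) = q ^ (-n²)` from the window. The trimmed window keeps a positive proportion of its length
for large `q` if `τ₂ < n (n - 1)`, and at equality if the constant in `ω` exceeds `1`. For a
constant `c < 1` the whole window lies too close to `P / q ^ n`, and no point survives
(`exactOrder_eq_empty`). -/

namespace ExactApprox

open MeasureTheory Topology

/-! ### Dimension of homogeneous Cantor schemes -/

/-- A lower bound for the Hausdorff dimension of a set containing all limit points of a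
homogeneous Cantor scheme. The sets of level `k` are indexed by natural numbers, and the children
of `I k a` are the sets `I (k + 1) (m k * a + d)` with `d < m k`. -/
theorem le_dimH_of_cantor_scheme {s C : ℝ} (hs : 0 < s) (hs1 : s ≤ 1) {m M : ℕ → ℕ}
    (hM0 : M 0 = 1) (hM : ∀ k, M (k + 1) = M k * m k) (hm : ∀ k, 2 ≤ m k)
    {I : ℕ → ℕ → Set ℝ} (hIc : ∀ k a, IsCompact (I k a)) (hIn : ∀ k a, (I k a).Nonempty)
    (hsub : ∀ k a, I (k + 1) a ⊆ I k (a / m k)) {ε : ℕ → ℝ} (hε : ∀ k, 0 < ε k)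
    (hsep : ∀ k a a', a / m k = a' / m k → ∀ x ∈ I (k + 1) a, ∀ y ∈ I (k + 1) a',
      |(a : ℝ) - a'| * ε k ≤ |x - y|)
    (hC : ∀ k, 2 / (M k : ℝ) ≤ C * (m k * ε k) ^ s) {E : Set ℝ}
    (hE : ∀ a : ℕ → ℕ, (∀ k, a k = a (k + 1) / m k) → ∀ x, (∀ k, x ∈ I k (a k)) → x ∈ E) :
    ENNReal.ofReal s ≤ dimH E := by
  have hMpow : ∀ k, 2 ^ k ≤ M k := by
    intro k
    induction k with
    | zero => simp [hM0]
    | succ k ih => rw [hM, pow_succ]; exact Nat.mul_le_mul ih (hm k)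
  have hMpos : ∀ k, (0 : ℝ) < M k := fun k => by
    exact_mod_cast lt_of_lt_of_le (by positivity) (hMpow k)
  have hmpos : ∀ k, (0 : ℝ) < m k := fun k => by
    exact_mod_cast lt_of_lt_of_le (by norm_num) (hm k)
  have hC0 : 0 ≤ C := by
    by_contra! h
    have h1 := hC 0
    have h2 : 0 < 2 / (M 0 : ℝ) := div_pos two_pos (hMpos 0)
    have h3 : 0 ≤ (m 0 * ε 0) ^ s := Real.rpow_nonneg (mul_pos (hmpos 0) (hε 0)).le _
    nlinarith
  -- The address of `t` consists of the truncations of its mixed-radix expansion with radices `m k`.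
  -- It parametrises points of the Cantor set by `[0, 1)`.
  set a : ℝ → ℕ → ℕ := fun t k => ⌊(M k : ℝ) * t⌋₊ with ha
  have hadiv : ∀ t k, a t k = a t (k + 1) / m k := by
    intro t k
    simp only [ha]
    rw [← Nat.floor_div_natCast, hM]
    congr 1
    push_cast
    field_simp [(hmpos k).ne']
  have hne : ∀ t, ∃ x, ∀ k, x ∈ I k (a t k) := by
    intro t
    have := IsCompact.nonempty_iInter_of_sequence_nonempty_isCompact_isClosed
      (fun k => I k (a t k)) (fun k => by
        have := hsub k (a t (k + 1)); rwa [← hadiv] at this)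
      (fun k => hIn _ _) (hIc _ _) (fun k => (hIc _ _).isClosed)
    simpa [Set.Nonempty] using this
  choose g hg using hne
  have hgE : ∀ t, g t ∈ E := fun t => hE (a t) (hadiv t) _ (hg t)
  -- The inverse of the parametrisation is `s`-Hölder, so the image of `[0, 1)` has dimension at
  -- least `s`. The estimate is made at the first level where the two addresses differ; their
  -- parents there still agree.
  have key : ∀ t ∈ Set.Ico (0 : ℝ) 1, ∀ t' ∈ Set.Ico (0 : ℝ) 1,
      |t - t'| ≤ C * |g t - g t'| ^ s := by
    intro t ht t' ht'
    rcases eq_or_ne t t' with rfl | hne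
    · simp [Real.zero_rpow hs.ne']
    have hfl : ∀ k u, u ∈ Set.Ico (0 : ℝ) 1 → (a u k : ℝ) ≤ M k * u ∧ M k * u < a u k + 1 :=
      fun k u hu => ⟨Nat.floor_le (mul_nonneg (hMpos k).le hu.1), Nat.lt_floor_add_one _⟩
    have hex : ∃ k, a t k ≠ a t' k := by
      by_contra! h
      obtain ⟨k, hk⟩ := pow_unbounded_of_one_lt (1 / |t - t'|) (one_lt_two (α := ℝ))
      have h1 := hfl k t ht
      have h2 := hfl k t' ht'
      rw [h k] at h1
      have h3 : |(M k : ℝ) * t - M k * t'| < 1 := by rw [abs_lt]; constructor <;> linarith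
      rw [← mul_sub, abs_mul, abs_of_pos (hMpos k)] at h3
      have h4 : (2 : ℝ) ^ k ≤ M k := by exact_mod_cast hMpow k
      have h5 : 0 < |t - t'| := abs_pos.2 (sub_ne_zero.2 hne)
      rw [div_lt_iff₀ h5] at hk
      nlinarith
    classical
    obtain ⟨j, hj⟩ : ∃ j, Nat.find hex = j + 1 := by
      refine Nat.exists_eq_succ_of_ne_zero fun h0 => Nat.find_spec hex ?_
      rw [h0]
      simp only [ha, hM0, Nat.cast_one, one_mul]
      rw [Nat.floor_eq_zero.2 ht.2, Nat.floor_eq_zero.2 ht'.2]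
    have hnej : a t (j + 1) ≠ a t' (j + 1) := hj ▸ Nat.find_spec hex
    have heq : a t j = a t' j := by
      by_contra h
      have := Nat.find_min' hex h
      omega
    have hpar : a t (j + 1) / m j = a t' (j + 1) / m j := by rw [← hadiv, ← hadiv, heq]
    have hdist := hsep j _ _ hpar _ (hg t (j + 1)) _ (hg t' (j + 1))
    set D : ℝ := |(a t (j + 1) : ℝ) - a t' (j + 1)| with hD
    have hD1 : 1 ≤ D := by
      have : (1 : ℤ) ≤ |(a t (j + 1) : ℤ) - a t' (j + 1)| :=
        Int.one_le_abs (sub_ne_zero.2 (by exact_mod_cast hnej))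
      rw [hD]; exact_mod_cast this
    have hDm : D ≤ m j := by
      have e1 := Nat.div_add_mod (a t (j + 1)) (m j)
      have e2 := Nat.div_add_mod (a t' (j + 1)) (m j)
      have l1 := Nat.mod_lt (a t (j + 1)) (lt_of_lt_of_le two_pos (hm j))
      have l2 := Nat.mod_lt (a t' (j + 1)) (lt_of_lt_of_le two_pos (hm j))
      rw [hpar] at e1
      have : |(a t (j + 1) : ℤ) - a t' (j + 1)| ≤ m j := by
        rw [abs_le]; constructor <;> omega
      rw [hD]; exact_mod_cast this
    have h1 : |t - t'| ≤ 2 * D / (M j * m j) := by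
      have h1 := hfl (j + 1) t ht
      have h2 := hfl (j + 1) t' ht'
      have h3 : |(M (j + 1) : ℝ) * t - M (j + 1) * t'| ≤ D + 1 := by
        have u1 := le_abs_self ((a t (j + 1) : ℝ) - a t' (j + 1))
        have u2 := neg_abs_le ((a t (j + 1) : ℝ) - a t' (j + 1))
        rw [abs_le]; constructor <;> linarith
      rw [← mul_sub, abs_mul, abs_of_pos (hMpos _), hM] at h3
      push_cast at h3
      rw [le_div_iff₀ (mul_pos (hMpos j) (hmpos j))]
      nlinarith
    have hDpos : 0 < D := by linarith
    -- Siblings have `D ≤ m j`, so `s ≤ 1` only increases the power; this lets `hC`, which concerns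
    -- whole families of siblings, control siblings at any distance.
    have h2 : D / m j ≤ (D / m j) ^ s := by
      have := Real.rpow_le_rpow_of_exponent_ge (x := D / m j) (div_pos hDpos (hmpos j))
        ((div_le_one (hmpos j)).2 hDm) hs1
      rwa [Real.rpow_one] at this
    calc |t - t'| ≤ 2 * D / (M j * m j) := h1
      _ = (D / m j) * (2 / M j) := by field_simp
      _ ≤ (D / m j) ^ s * (C * (m j * ε j) ^ s) := by
          gcongr
          exact hC j
      _ = C * (D * ε j) ^ s := by
          have : D * ε j = (D / m j) * (m j * ε j) := by field_simp [(hmpos j).ne']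
          rw [this, Real.mul_rpow (div_pos hDpos (hmpos j)).le (mul_pos (hmpos j) (hε j)).le]
          ring
      _ ≤ C * |g t - g t'| ^ s := by
          gcongr
          exact mul_nonneg hDpos.le (hε j).le
  have hinj : Set.InjOn g (Set.Ico (0 : ℝ) 1) := by
    intro t ht t' ht' h
    have := key t ht t' ht'
    rw [h, sub_self, abs_zero, Real.zero_rpow hs.ne', mul_zero] at this
    exact sub_eq_zero.1 (abs_nonpos_iff.1 this)
  set f := Function.invFunOn g (Set.Ico (0 : ℝ) 1) with hf
  have hfg : ∀ t ∈ Set.Ico (0 : ℝ) 1, f (g t) = t := fun t ht => hinj.leftInvOn_invFunOn ht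
  have hhol : HolderOnWith C.toNNReal s.toNNReal f (g '' Set.Ico (0 : ℝ) 1) := by
    rintro _ ⟨t, ht, rfl⟩ _ ⟨t', ht', rfl⟩
    rw [hfg t ht, hfg t' ht', edist_dist, edist_dist, Real.dist_eq, Real.dist_eq,
      Real.coe_toNNReal s hs.le, ENNReal.ofReal_rpow_of_nonneg (abs_nonneg _) hs.le]
    change _ ≤ ENNReal.ofReal C * _
    rw [← ENNReal.ofReal_mul hC0]
    exact ENNReal.ofReal_le_ofReal (key t ht t' ht')
  have himg : f '' (g '' Set.Ico (0 : ℝ) 1) = Set.Ico (0 : ℝ) 1 := by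
    rw [← Set.image_comp]
    exact (Set.image_congr fun t ht => hfg t ht).trans (Set.image_id _)
  have h1 := hhol.dimH_image_le (Real.toNNReal_pos.2 hs)
  rw [himg, Real.dimH_of_mem_nhds (x := 1 / 2) (Ico_mem_nhds (by norm_num) (by norm_num)),
    Module.finrank_self, Nat.cast_one] at h1
  have h3 : (1 : ENNReal) * ENNReal.ofReal s ≤ dimH (g '' Set.Ico (0 : ℝ) 1) :=
    (ENNReal.le_div_iff_mul_le (Or.inl (by simpa [ENNReal.ofReal] using hs))
      (Or.inl ENNReal.ofReal_ne_top)).1 h1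
  rw [one_mul] at h3
  refine h3.trans (dimH_mono ?_)
  rintro _ ⟨t, -, rfl⟩
  exact hgE t

/-! ### Upper bound by covering -/

/-- Each denominator admits only finitely many numerators, so infinitely many pairs force infinitely
many denominators. -/
lemma frequently_of_mem_wellApprox {Ψ : ℝ → ℝ} {x : ℝ} (hx : x ∈ wellApprox Ψ) :
    ∃ᶠ q : ℕ in atTop, ∃ p : ℤ, |x - (p : ℝ) / (q : ℝ)| ≤ Ψ (q : ℝ) := by
  intro hev
  obtain ⟨Q, hQ⟩ := eventually_atTop.1 hev
  refine hx (Set.Finite.subset (s := ⋃ q ∈ Set.Iio Q,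
    (fun p : ℤ => (p, q)) '' Set.Icc ⌈q * (x - Ψ q)⌉ ⌊q * (x + Ψ q)⌋) ?_ ?_)
  · exact (Set.finite_Iio Q).biUnion fun q _ => (Set.finite_Icc _ _).image _
  · rintro ⟨p, q⟩ ⟨hq, hpq⟩
    have hlt : q < Q := by
      by_contra! h
      exact hQ q h ⟨p, hpq⟩
    have hq' : (0 : ℝ) < q := by exact_mod_cast hq
    simp only [Set.mem_iUnion, Set.mem_Iio]
    refine ⟨q, hlt, p, ?_, rfl⟩
    rw [abs_le] at hpq
    have hp : (p : ℝ) = q * (p / q) := by field_simp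
    constructor
    · rw [Int.ceil_le, hp]
      exact mul_le_mul_of_nonneg_left (by linarith [hpq.2]) hq'.le
    · rw [Int.le_floor, hp]
      exact mul_le_mul_of_nonneg_left (by linarith [hpq.1]) hq'.le

lemma frequently_of_mem_exactOrder {Ψ ω : ℝ → ℝ} {x : ℝ} (hx : x ∈ exactOrder Ψ ω) :
    ∃ᶠ q : ℕ in atTop, ∃ p : ℤ, (1 - ω q) * Ψ q ≤ |x - (p : ℝ) / (q : ℝ)| ∧
      |x - (p : ℝ) / (q : ℝ)| ≤ Ψ (q : ℝ) :=
  ((frequently_of_mem_wellApprox hx.1).and_eventually hx.2).mono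
    fun _ ⟨⟨p, hp⟩, hq⟩ => ⟨p, hq p, hp⟩

/-- The covering bound for the Hausdorff dimension of the points of exact order. -/
theorem dimH_exactOrder_le {Ψ ω : ℝ → ℝ} {A σ : ℝ} (hA : 0 ≤ A) (hσ : 0 < σ)
    (h : ∀ᶠ q : ℕ in atTop, Ψ q ≤ 1 ∧ ω q * Ψ q = A * (q : ℝ) ^ (-σ)) :
    dimH (exactOrder Ψ ω) ≤ ENNReal.ofReal (2 / σ) := by
  have hcov : exactOrder Ψ ω ⊆ ⋃ z : ℤ, exactOrder Ψ ω ∩ Set.Icc (z : ℝ) (z + 1) := fun x hx =>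
    Set.mem_iUnion.2 ⟨⌊x⌋, hx, Int.floor_le x, (Int.lt_floor_add_one x).le⟩
  refine (dimH_mono hcov).trans ?_
  rw [dimH_iUnion]
  refine iSup_le fun z => ?_
  by_contra! hlt
  obtain ⟨d, hd1, hd2⟩ := ENNReal.lt_iff_exists_nnreal_btwn.1 hlt
  refine absurd (dimH_le_of_hausdorffMeasure_ne_top (d := d) ?_) (not_le.2 hd2)
  have hd : 2 / σ < d := by
    rwa [← ENNReal.ofReal_coe_nnreal, ENNReal.ofReal_lt_ofReal_iff_of_nonneg (by positivity)] at hd1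
  have hd0 : (0 : ℝ) < d := lt_trans (by positivity) hd
  rw [div_lt_iff₀ hσ] at hd
  set F : ℕ → ENNReal := fun q => ENNReal.ofReal (8 * A ^ (d : ℝ) * (q : ℝ) ^ (1 - σ * d)) with hF
  have hFsum : ∑' q, F q ≠ ⊤ := by
    have : Summable fun q : ℕ => 8 * A ^ (d : ℝ) * (q : ℝ) ^ (1 - σ * d) :=
      (Real.summable_nat_rpow.2 (by linarith [mul_comm σ (d : ℝ)])).mul_left _
    exact this.tsum_ofReal_ne_top
  set cen : ℕ → ℕ → ℝ := fun q i => ((((z - 1) * q + i : ℤ)) : ℝ) / q with hcen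
  -- The `n`-th cover uses the denominators `q = k + n`. Since `Ψ q ≤ 1`, the numerators lie between
  -- `(z - 1) q` and `(z + 2) q`, which gives `3 q + 1` of them; the Boolean selects the window to
  -- the right or left of the centre.
  let ι : ℕ → Type := fun n => Σ k : ℕ, Fin (3 * (k + n) + 1) × Bool
  let t : (n : ℕ) → ι n → Set ℝ := fun n i =>
    if i.2.2 then Set.Icc (cen (i.1 + n) i.2.1 + (Ψ ((i.1 + n : ℕ) : ℝ) -
        A * ((i.1 + n : ℕ) : ℝ) ^ (-σ))) (cen (i.1 + n) i.2.1 + Ψ ((i.1 + n : ℕ) : ℝ))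
    else Set.Icc (cen (i.1 + n) i.2.1 - Ψ ((i.1 + n : ℕ) : ℝ))
      (cen (i.1 + n) i.2.1 - Ψ ((i.1 + n : ℕ) : ℝ) + A * ((i.1 + n : ℕ) : ℝ) ^ (-σ))
  have hdiam : ∀ n i, Metric.ediam (t n i) = ENNReal.ofReal (A * ((i.1 + n : ℕ) : ℝ) ^ (-σ)) := by
    intro n i
    simp only [t]
    split_ifs <;> rw [Real.ediam_Icc] <;> congr 1 <;> ring
  have htend : Tendsto (fun n : ℕ => ENNReal.ofReal (A * (n : ℝ) ^ (-σ))) atTop (𝓝 0) := by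
    have : Tendsto (fun n : ℕ => A * (n : ℝ) ^ (-σ)) atTop (𝓝 (A * 0)) :=
      ((tendsto_rpow_neg_atTop hσ).comp tendsto_natCast_atTop_atTop).const_mul A
    rw [mul_zero] at this
    simpa using ENNReal.tendsto_ofReal this
  have hle := Measure.hausdorffMeasure_le_liminf_tsum (d : ℝ)
    (exactOrder Ψ ω ∩ Set.Icc (z : ℝ) (z + 1)) (l := atTop) _ htend t ?_ ?_
  · have hlim : Tendsto (fun n : ℕ => ∑' i : ι n, Metric.ediam (t n i) ^ (d : ℝ)) atTop (𝓝 0) := by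
      refine tendsto_of_tendsto_of_tendsto_of_le_of_le' tendsto_const_nhds
        (ENNReal.tendsto_sum_nat_add F hFsum) (Eventually.of_forall fun _ => bot_le) ?_
      filter_upwards [eventually_ge_atTop 1] with n hn
      rw [ENNReal.tsum_sigma']
      refine ENNReal.tsum_le_tsum fun k => ?_
      simp only [hdiam]
      rw [ENNReal.tsum_const]
      have hq1 : (1 : ℝ) ≤ (k + n : ℕ) := by exact_mod_cast le_add_left hn
      have hq0 : (0 : ℝ) < (k + n : ℕ) := by linarith
      rw [ENat.card_eq_coe_fintype_card, Fintype.card_prod, Fintype.card_fin, Fintype.card_bool]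
      rw [ENNReal.ofReal_rpow_of_nonneg (by positivity) hd0.le, hF]
      have : (((((3 * (k + n) + 1) * 2 : ℕ) : ENat)) : ENNReal)
          = ENNReal.ofReal ((((3 * (k + n) + 1) * 2 : ℕ)) : ℝ) := by
        rw [ENNReal.ofReal_natCast]; rfl
      rw [this, ← ENNReal.ofReal_mul (by positivity)]
      refine ENNReal.ofReal_le_ofReal ?_
      rw [Real.mul_rpow hA (by positivity), ← Real.rpow_mul hq0.le, neg_mul, sub_eq_add_neg,
        Real.rpow_add hq0, Real.rpow_one]
      have h1 : ((((3 * (k + n) + 1) * 2 : ℕ)) : ℝ) ≤ 8 * ((k + n : ℕ) : ℝ) := by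
        push_cast at hq1 ⊢; linarith
      calc _ ≤ 8 * ((k + n : ℕ) : ℝ) * (A ^ (d : ℝ) * ((k + n : ℕ) : ℝ) ^ (-(σ * d))) := by gcongr
        _ = _ := by ring
    rw [hlim.liminf_eq] at hle
    exact (lt_of_le_of_lt hle ENNReal.zero_lt_top).ne
  · filter_upwards [eventually_ge_atTop 1] with n hn i
    rw [hdiam]
    refine ENNReal.ofReal_le_ofReal (mul_le_mul_of_nonneg_left ?_ hA)
    exact Real.rpow_le_rpow_of_nonpos (by exact_mod_cast hn) (by push_cast; linarith [Nat.cast_nonneg (α := ℝ) i.1])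
      (by linarith)
  · obtain ⟨Q, hQ⟩ := eventually_atTop.1 h
    filter_upwards [eventually_ge_atTop (max Q 1)] with n hn
    rintro x ⟨hx, hxz⟩
    obtain ⟨q, hqn, p, hp1, hp2⟩ := (frequently_atTop.1 (frequently_of_mem_exactOrder hx)) n
    obtain ⟨k, rfl⟩ := Nat.exists_eq_add_of_le' hqn
    obtain ⟨hΨ, hω⟩ := hQ (k + n) (by omega)
    have hq0 : (0 : ℝ) < (k + n : ℕ) := by exact_mod_cast (by omega)
    have habs := abs_le.1 (hp2.trans hΨ)
    have hpq : (p : ℝ) = (p / (k + n : ℕ)) * (k + n : ℕ) := by field_simp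
    have hlo : (z - 1) * (k + n : ℕ) ≤ p := by
      have : ((z : ℝ) - 1) * (k + n : ℕ) ≤ p := by
        rw [hpq]; exact mul_le_mul_of_nonneg_right (by linarith [hxz.1, habs.2]) hq0.le
      exact_mod_cast this
    have hhi : p ≤ (z + 2) * (k + n : ℕ) := by
      have : (p : ℝ) ≤ ((z : ℝ) + 2) * (k + n : ℕ) := by
        rw [hpq]; exact mul_le_mul_of_nonneg_right (by linarith [hxz.2, habs.1]) hq0.le
      exact_mod_cast this
    obtain ⟨i, hi⟩ := Int.eq_ofNat_of_zero_le (sub_nonneg.2 hlo)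
    have hilt : i < 3 * (k + n) + 1 := by
      have : (i : ℤ) ≤ 3 * ((k + n : ℕ) : ℤ) := by rw [← hi]; linarith
      omega
    have hpi : cen (k + n) i = (p : ℝ) / (k + n : ℕ) := by
      simp only [hcen, ← hi]
      congr 2
      ring
    rw [one_sub_mul, hω] at hp1
    rw [Set.mem_iUnion]
    rcases le_total 0 (x - (p : ℝ) / (k + n : ℕ)) with hs | hs
    · rw [abs_of_nonneg hs] at hp1 hp2
      refine ⟨⟨k, ⟨i, hilt⟩, true⟩, ?_⟩
      simp only [t, hpi, if_true]
      exact ⟨by linarith, by linarith⟩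
    · rw [abs_of_nonpos hs] at hp1 hp2
      refine ⟨⟨k, ⟨i, hilt⟩, false⟩, ?_⟩
      simp only [t, hpi, Bool.false_eq_true, if_false]
      exact ⟨by linarith, by linarith⟩

/-! ### Emptiness below the critical constant -/

theorem exactOrder_eq_empty {n : ℕ} (hn : 2 ≤ n) {c : ℝ} (hc : 0 < c) (hc1 : c < 1) :
    exactOrder (fun q : ℝ => q ^ (-(n : ℝ)))
      (fun q : ℝ => c * q ^ (-((n : ℝ) * ((n : ℝ) - 1)))) = ∅ := by
  have hn' : (2 : ℝ) ≤ n := by exact_mod_cast hn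
  refine Set.eq_empty_iff_forall_notMem.2 fun x hx => ?_
  have htQ : Tendsto (fun q : ℕ => q ^ n) atTop atTop := tendsto_pow_atTop (by omega)
  have hω : ∀ᶠ q : ℕ in atTop,
      c * (((q ^ n : ℕ) : ℝ)) ^ (-((n : ℝ) * ((n : ℝ) - 1))) < 1 - c := by
    have h1 : Tendsto (fun q : ℕ => c * (q : ℝ) ^ (-((n : ℝ) * ((n : ℝ) - 1)))) atTop
        (𝓝 (c * 0)) :=
      ((tendsto_rpow_neg_atTop (by nlinarith)).comp tendsto_natCast_atTop_atTop).const_mul c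
    exact (h1.comp htQ).eventually_lt_const (by linarith)
  obtain ⟨q, ⟨p, hp1, hp2⟩, hq1, hq2, hq3⟩ := ((frequently_of_mem_exactOrder hx).and_eventually
    ((eventually_ge_atTop 1).and (hω.and (htQ.eventually hx.2)))).exists
  have hq0 : (0 : ℝ) < q := by exact_mod_cast hq1
  have hpow : (q : ℝ) ^ n = q ^ (n - 1) * q := by rw [← pow_succ]; congr 1; omega
  have hQrpow : (((q ^ n : ℕ) : ℝ)) ^ (-(n : ℝ)) = (q : ℝ) ^ (-((n : ℝ) * n)) := by
    rw [Nat.cast_pow, ← Real.rpow_natCast, ← Real.rpow_mul hq0.le]; congr 1; ring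
  have hωΨ : c * (q : ℝ) ^ (-((n : ℝ) * ((n : ℝ) - 1))) * (q : ℝ) ^ (-(n : ℝ))
      = c * (q : ℝ) ^ (-((n : ℝ) * n)) := by
    rw [mul_assoc, ← Real.rpow_add hq0]; congr 2; ring
  have hpos : 0 < (q : ℝ) ^ (-((n : ℝ) * n)) := Real.rpow_pos_of_pos hq0 _
  have hone : (q : ℝ) ^ (-(n : ℝ)) = 1 / (q : ℝ) ^ n := by
    rw [Real.rpow_neg hq0.le, Real.rpow_natCast, one_div]
  -- The outer endpoint `p / q ± q ^ (-n)` of the window has denominator `q ^ n`, and the window has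
  -- length `c * Ψ (q ^ n)`. With `ω (q ^ n) < 1 - c` this violates the lower bound required at `q ^
  -- n`.
  have hclose : ∃ P : ℤ, |x - (P : ℝ) / ((q ^ n : ℕ) : ℝ)| ≤ c * (q : ℝ) ^ (-((n : ℝ) * n)) := by
    rw [one_sub_mul, hωΨ] at hp1
    rcases le_total 0 (x - (p : ℝ) / q) with hs | hs
    · refine ⟨p * q ^ (n - 1) + 1, ?_⟩
      have : (((p * q ^ (n - 1) + 1 : ℤ)) : ℝ) / ((q ^ n : ℕ) : ℝ)
          = p / q + (q : ℝ) ^ (-(n : ℝ)) := by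
        push_cast; rw [hone, hpow]; field_simp
      rw [abs_of_nonneg hs] at hp1 hp2
      rw [this, abs_le]; constructor <;> linarith
    · refine ⟨p * q ^ (n - 1) - 1, ?_⟩
      have : (((p * q ^ (n - 1) - 1 : ℤ)) : ℝ) / ((q ^ n : ℕ) : ℝ)
          = p / q - (q : ℝ) ^ (-(n : ℝ)) := by
        push_cast; rw [hone, hpow]; field_simp
      rw [abs_of_nonpos hs] at hp1 hp2
      rw [this, abs_le]; constructor <;> linarith
  obtain ⟨P, hP⟩ := hclose
  have h3 := (hq3 P).trans hP
  beta_reduce at h3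
  rw [hQrpow] at h3
  nlinarith

/-! ### Spacing and counting of rationals -/

lemma one_div_mul_le_abs_div_sub_div {a p : ℤ} {b q : ℕ} (hb : 0 < b) (hq : 0 < q)
    (hne : (a : ℝ) / b ≠ (p : ℝ) / q) : 1 / ((b : ℝ) * q) ≤ |(a : ℝ) / b - (p : ℝ) / q| := by
  have hb' : (0 : ℝ) < b := by exact_mod_cast hb
  have hq' : (0 : ℝ) < q := by exact_mod_cast hq
  rw [div_sub_div _ _ hb'.ne' hq'.ne', abs_div, abs_of_pos (mul_pos hb' hq')]
  gcongr
  have hne' : a * q - b * p ≠ 0 := by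
    intro h
    refine hne ?_
    rw [div_eq_div_iff hb'.ne' hq'.ne']
    have : (a : ℝ) * q - b * p = 0 := by exact_mod_cast h
    linarith
  exact_mod_cast Int.one_le_abs hne'

lemma den_dvd_of_div_eq {r : ℚ} {a : ℤ} {b : ℕ} (h : (a : ℝ) / b = r) : r.den ∣ b := by
  have h1 : (a : ℚ) / b = r := by exact_mod_cast h
  have h2 := Rat.den_dvd a b
  rw [Rat.divInt_eq_div, Int.cast_natCast, h1] at h2
  exact_mod_cast h2

lemma one_div_sq_le_sub {r r' : ℚ} (h : r < r') {N : ℕ} (hr : r.den ≤ N) (hr' : r'.den ≤ N) :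
    1 / (N : ℝ) ^ 2 ≤ (r' : ℝ) - r := by
  have h1 := one_div_mul_le_abs_div_sub_div (a := r'.num) (p := r.num) r'.den_pos r.den_pos (by
    rw [← Rat.cast_def, ← Rat.cast_def]; exact_mod_cast h.ne')
  rw [← Rat.cast_def, ← Rat.cast_def, abs_of_pos (sub_pos.2 (by exact_mod_cast h))] at h1
  refine le_trans ?_ h1
  have e1 : (0 : ℝ) < r.den := by exact_mod_cast r.den_pos
  have e2 : (0 : ℝ) < r'.den := by exact_mod_cast r'.den_pos
  have e3 : (r.den : ℝ) ≤ N := by exact_mod_cast hr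
  have e4 : (r'.den : ℝ) ≤ N := by exact_mod_cast hr'
  rw [sq]
  gcongr

/-- An increasing enumeration of rationals with denominators at most `N` grows linearly. -/
lemma sub_div_sq_le_of_strictMono {m N : ℕ} {f : Fin m → ℚ} (hf : StrictMono f)
    (hden : ∀ i, (f i).den ≤ N) {i j : Fin m} (hij : i ≤ j) :
    ((j : ℝ) - i) / (N : ℝ) ^ 2 ≤ (f j : ℝ) - f i := by
  obtain ⟨i, hi⟩ := i
  obtain ⟨j, hj⟩ := j
  simp only [Fin.mk_le_mk] at hij
  obtain ⟨d, rfl⟩ := Nat.exists_eq_add_of_le hij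
  clear hij
  induction d with
  | zero => simp
  | succ d ih =>
    have h1 := ih (by omega)
    have h2 := one_div_sq_le_sub (hf (a := ⟨i + d, by omega⟩) (b := ⟨i + (d + 1), hj⟩)
      (by simp)) (hden _) (hden _)
    push_cast at h1 ⊢
    rw [show ((i : ℝ) + (d + 1) - i) = (i + d - i) + 1 by ring, add_div]
    linarith

lemma card_le_of_den_le {F : Finset ℚ} {N : ℕ} (hN : 0 < N) {u l : ℝ}
    (hden : ∀ r ∈ F, r.den ≤ N) (hF : ∀ r ∈ F, (r : ℝ) ∈ Set.Icc u (u + l)) (hl : 0 ≤ l) :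
    (F.card : ℝ) ≤ l * (N : ℝ) ^ 2 + 1 := by
  rcases Nat.eq_zero_or_pos F.card with h0 | h0
  · rw [h0]; push_cast; positivity
  · have hN' : (0 : ℝ) < (N : ℝ) ^ 2 := by positivity
    have h1 := sub_div_sq_le_of_strictMono (F.orderEmbOfFin rfl).strictMono
      (fun i => hden _ (F.orderEmbOfFin_mem rfl i)) (i := ⟨0, h0⟩) (j := ⟨F.card - 1, by omega⟩)
      (by simp)
    have h2 := hF _ (F.orderEmbOfFin_mem rfl ⟨0, h0⟩)
    have h3 := hF _ (F.orderEmbOfFin_mem rfl ⟨F.card - 1, by omega⟩)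
    rw [div_le_iff₀ hN'] at h1
    simp only [Nat.cast_zero, sub_zero] at h1
    rw [Nat.cast_sub h0, Nat.cast_one] at h1
    have h4 : (((F.orderEmbOfFin rfl ⟨F.card - 1, by omega⟩ : ℚ) : ℝ)
      - (F.orderEmbOfFin rfl ⟨0, h0⟩ : ℚ)) * (N : ℝ) ^ 2 ≤ l * (N : ℝ) ^ 2 :=
      mul_le_mul_of_nonneg_right (by linarith [h2.1, h3.2]) hN'.le
    linarith

lemma finite_setOf_den_le {N : ℕ} (hN : 0 < N) (u : ℝ) {l : ℝ} (hl : 0 ≤ l) :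
    {r : ℚ | r.den ≤ N ∧ (r : ℝ) ∈ Set.Icc u (u + l)}.Finite := by
  by_contra h
  obtain ⟨F, hF, hc⟩ := Set.Infinite.exists_subset_card_eq h (⌊l * (N : ℝ) ^ 2 + 1⌋₊ + 1)
  have := card_le_of_den_le hN (fun r hr => (hF hr).1) (fun r hr => (hF hr).2) hl
  rw [hc] at this
  push_cast at this
  linarith [Nat.lt_floor_add_one (l * (N : ℝ) ^ 2 + 1)]

/-! ### Measure of points close to rationals -/

lemma volume_le_card_mul {α : Type*} {T : Finset α} {f : α → ℝ} {S : Set ℝ} {ρ : ℝ}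
    (hS : ∀ x ∈ S, ∃ r ∈ T, |x - f r| ≤ ρ) : volume S ≤ ENNReal.ofReal (T.card * (2 * ρ)) := by
  have hsub : S ⊆ ⋃ r ∈ T, Metric.closedBall (f r) ρ := by
    intro x hx
    obtain ⟨r, hr, h⟩ := hS x hx
    simp only [Set.mem_iUnion]
    exact ⟨r, hr, by rwa [Metric.mem_closedBall, Real.dist_eq]⟩
  calc volume S ≤ _ := measure_mono hsub
    _ ≤ ∑ r ∈ T, volume (Metric.closedBall (f r) ρ) := measure_biUnion_finset_le _ _
    _ = _ := by
      simp only [Real.volume_closedBall, Finset.sum_const, nsmul_eq_mul]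
      rw [ENNReal.ofReal_mul (p := (T.card : ℝ)) (Nat.cast_nonneg _), ENNReal.ofReal_natCast]

lemma volume_near_rat_le {τ : ℝ} (hτ : 2 < τ) (u : ℝ) {l : ℝ} (hl : 0 ≤ l) {R : ℝ} (hR : 1 ≤ R) :
    volume {x | x ∈ Set.Icc u (u + l) ∧ ∃ r : ℚ, (r.den : ℝ) ≤ 2 * R ∧ |x - r| ≤ 2 * R ^ (-τ)}
      ≤ ENNReal.ofReal (16 * l * R ^ (2 - τ) + 68 * R ^ (-τ)) := by
  have hR0 : 0 < R := by linarith
  set ρ := 2 * R ^ (-τ) with hρ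
  have hρ0 : 0 < ρ := by positivity
  have hN : 0 < ⌊2 * R⌋₊ := Nat.floor_pos.2 (by linarith)
  have hfin := finite_setOf_den_le hN (u - ρ) (l := l + 2 * ρ) (by positivity)
  have hcard := card_le_of_den_le (F := hfin.toFinset) hN
    (fun r hr => ((Set.Finite.mem_toFinset _).1 hr).1)
    (fun r hr => ((Set.Finite.mem_toFinset _).1 hr).2) (by positivity)
  refine (volume_le_card_mul (T := hfin.toFinset) (f := fun r : ℚ => (r : ℝ)) (ρ := ρ) ?_).trans ?_
  · rintro x ⟨hx, r, hr, hxr⟩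
    refine ⟨r, (Set.Finite.mem_toFinset _).2 ⟨Nat.le_floor hr, ?_⟩, hxr⟩
    rw [abs_le] at hxr
    constructor <;> linarith [hx.1, hx.2, hxr.1, hxr.2]
  · refine ENNReal.ofReal_le_ofReal ?_
    have h1 : (⌊2 * R⌋₊ : ℝ) ^ 2 ≤ 4 * R ^ 2 := by
      have := Nat.floor_le (a := 2 * R) (by linarith)
      calc (⌊2 * R⌋₊ : ℝ) ^ 2 ≤ (2 * R) ^ 2 := by gcongr
        _ = _ := by ring
    have h2 : R ^ (2 - τ) = R ^ 2 * R ^ (-τ) := by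
      rw [sub_eq_add_neg, Real.rpow_add hR0, Real.rpow_two]
    have h3 : R ^ 2 * R ^ (-τ) ≤ 1 := by
      rw [← h2]; exact Real.rpow_le_one_of_one_le_of_nonpos hR (by linarith)
    have h4 : 0 < R ^ (-τ) := by positivity
    calc (hfin.toFinset.card : ℝ) * (2 * ρ)
        ≤ ((l + 2 * ρ) * (4 * R ^ 2) + 1) * (2 * ρ) := by
          gcongr
          exact hcard.trans (by gcongr)
      _ = 16 * l * (R ^ 2 * R ^ (-τ)) + 64 * (R ^ 2 * R ^ (-τ)) * R ^ (-τ) + 4 * R ^ (-τ) := by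
          rw [hρ]; ring
      _ ≤ 16 * l * (R ^ 2 * R ^ (-τ)) + 64 * 1 * R ^ (-τ) + 4 * R ^ (-τ) := by gcongr
      _ = _ := by rw [h2]; ring

/-- The measure of the points of an interval lying too close to some rational of large
denominator. -/
lemma exists_volume_bad_le {τ : ℝ} (hτ : 2 < τ) : ∃ K : ℝ, 0 < K ∧
    ∀ (u l B : ℝ), 0 ≤ l → 1 ≤ B →
      volume {x | x ∈ Set.Icc u (u + l) ∧ ∃ (b : ℕ) (a : ℤ), B ≤ b ∧
        |x - (a : ℝ) / b| < 2 * (b : ℝ) ^ (-τ)}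
      ≤ ENNReal.ofReal (K * (l * B ^ (2 - τ) + B ^ (-τ))) := by
  set θ : ℝ := 2 ^ (2 - τ) with hθ
  have hθ0 : 0 < θ := by positivity
  have hθ1 : θ < 1 := Real.rpow_lt_one_of_one_lt_of_neg one_lt_two (by linarith)
  have hpos : 0 < 1 - θ := by linarith
  refine ⟨68 * (1 - θ)⁻¹, by positivity, fun u l B hl hB => ?_⟩
  have hB0 : 0 < B := by linarith
  -- Denominators are split into dyadic blocks `2 ^ j * B ≤ b < 2 ^ (j + 1) * B`; the block bounds
  -- decay geometrically with ratio `2 ^ (2 - τ) < 1`.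
  have hcov : {x | x ∈ Set.Icc u (u + l) ∧ ∃ (b : ℕ) (a : ℤ), B ≤ b ∧
        |x - (a : ℝ) / b| < 2 * (b : ℝ) ^ (-τ)} ⊆
      ⋃ j : ℕ, {x | x ∈ Set.Icc u (u + l) ∧
        ∃ r : ℚ, (r.den : ℝ) ≤ 2 * (2 ^ j * B) ∧ |x - r| ≤ 2 * (2 ^ j * B) ^ (-τ)} := by
    rintro x ⟨hx, b, a, hb, hab⟩
    have hb0 : (0 : ℝ) < b := by linarith
    obtain ⟨j, hj1, hj2⟩ := exists_nat_pow_near (x := b / B) ((one_le_div hB0).2 hb)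
      (one_lt_two (α := ℝ))
    rw [le_div_iff₀ hB0] at hj1
    rw [div_lt_iff₀ hB0, pow_succ] at hj2
    refine Set.mem_iUnion.2 ⟨j, hx, (a : ℚ) / (b : ℕ), ?_, ?_⟩
    · have h1 : ((a : ℚ) / (b : ℕ)).den ≤ b := by
        have := Rat.den_dvd a b
        have := Int.le_of_dvd (by exact_mod_cast hb0) this
        exact_mod_cast this
      have : ((((a : ℚ) / (b : ℕ)).den : ℕ) : ℝ) ≤ b := by exact_mod_cast h1
      linarith
    · push_cast
      refine hab.le.trans ?_
      have := Real.rpow_le_rpow_of_nonpos (z := -τ) (by positivity) hj1 (by linarith)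
      linarith
  have hgeo : HasSum (fun j : ℕ => 68 * (l * B ^ (2 - τ) + B ^ (-τ)) * θ ^ j)
      (68 * (l * B ^ (2 - τ) + B ^ (-τ)) * (1 - θ)⁻¹) :=
    (hasSum_geometric_of_lt_one hθ0.le hθ1).mul_left _
  have hterm : ∀ j : ℕ, 16 * l * (2 ^ j * B) ^ (2 - τ) + 68 * (2 ^ j * B) ^ (-τ) ≤
      68 * (l * B ^ (2 - τ) + B ^ (-τ)) * θ ^ j := by
    intro j
    have e1 : ((2 : ℝ) ^ j) ^ (2 - τ) = θ ^ j := by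
      rw [hθ, ← Real.rpow_natCast, ← Real.rpow_natCast, ← Real.rpow_mul (by norm_num),
        ← Real.rpow_mul (by norm_num), mul_comm]
    have e2 : ((2 : ℝ) ^ j) ^ (-τ) ≤ θ ^ j := by
      rw [← e1]
      exact Real.rpow_le_rpow_of_exponent_le (one_le_pow₀ (by norm_num)) (by linarith)
    rw [Real.mul_rpow (by positivity) hB0.le, Real.mul_rpow (by positivity) hB0.le, e1]
    have p1 : 0 ≤ l * B ^ (2 - τ) * θ ^ j := by positivity
    have p2 := mul_le_mul_of_nonneg_right e2 (Real.rpow_nonneg hB0.le (-τ))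
    nlinarith
  calc _ ≤ _ := measure_mono hcov
    _ ≤ ∑' j : ℕ, _ := measure_iUnion_le _
    _ ≤ ∑' j : ℕ, ENNReal.ofReal (68 * (l * B ^ (2 - τ) + B ^ (-τ)) * θ ^ j) :=
        ENNReal.tsum_le_tsum fun j => (volume_near_rat_le hτ u hl
          (one_le_mul_of_one_le_of_one_le (one_le_pow₀ (by norm_num)) hB)).trans
          (ENNReal.ofReal_le_ofReal (hterm j))
    _ = ENNReal.ofReal (68 * (l * B ^ (2 - τ) + B ^ (-τ)) * (1 - θ)⁻¹) := by
        rw [← ENNReal.ofReal_tsum_of_nonneg (fun j => by positivity) hgeo.summable, hgeo.tsum_eq]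
    _ = _ := by congr 1; ring

/-- The measure of the points of an interval with a good approximation of small denominator. -/
lemma volume_small_den_le (u : ℝ) {l : ℝ} (hl : 0 ≤ l) {N : ℕ} (hN : 0 < N) :
    volume {x | x ∈ Set.Icc u (u + l) ∧ ∃ r : ℚ, 16 * r.den ≤ N ∧
      |x - r| ≤ 1 / ((N : ℝ) * r.den)} ≤
      ENNReal.ofReal (l / 8 + 6 * (1 + Real.log N) / N) := by
  have hN0 : (0 : ℝ) < N := by exact_mod_cast hN
  have hN1 : (1 : ℝ) ≤ N := by exact_mod_cast hN
  set S : ℕ → Set ℝ := fun i => {x | x ∈ Set.Icc u (u + l) ∧ ∃ p : ℤ,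
    |x - (p : ℝ) / (i + 1 : ℕ)| ≤ 1 / ((N : ℝ) * (i + 1 : ℕ))} with hS
  have hcov : {x | x ∈ Set.Icc u (u + l) ∧ ∃ r : ℚ, 16 * r.den ≤ N ∧
      |x - r| ≤ 1 / ((N : ℝ) * r.den)} ⊆ ⋃ i ∈ Finset.range (N / 16), S i := by
    rintro x ⟨hx, r, hr, hxr⟩
    simp only [Set.mem_iUnion]
    have hd := r.den_pos
    refine ⟨r.den - 1, Finset.mem_range.2 (by omega), hx, r.num, ?_⟩
    rw [Nat.sub_add_cancel hd, ← Rat.cast_def]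
    exact hxr
  -- With `q = i + 1`, at most `l q + 3` fractions matter, each covering length `2 / (N q)`. Summed
  -- over `q ≤ N / 16`, the main terms give `l / 8` and the others a harmonic sum.
  have hSi : ∀ i : ℕ, volume (S i) ≤ ENNReal.ofReal (2 * l / N + 6 / N * ((i + 1 : ℕ) : ℝ)⁻¹) := by
    intro i
    set q : ℝ := ((i + 1 : ℕ) : ℝ) with hq
    have hq1 : 1 ≤ q := by rw [hq]; exact_mod_cast Nat.le_add_left 1 i
    have hq0 : 0 < q := by linarith
    set T := Finset.Icc ⌈q * u - 1 / N⌉ ⌊q * (u + l) + 1 / N⌋ with hT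
    have hcard : (T.card : ℝ) ≤ l * q + 3 := by
      rw [hT, Int.card_Icc]
      have h1 := Int.le_ceil (q * u - 1 / (N : ℝ))
      have h2 := Int.floor_le (q * (u + l) + 1 / (N : ℝ))
      have h3 : 1 / (N : ℝ) ≤ 1 := (div_le_one hN0).2 hN1
      have h4 : ((⌊q * (u + l) + 1 / (N : ℝ)⌋ + 1 - ⌈q * u - 1 / (N : ℝ)⌉ : ℤ) : ℝ)
          ≤ l * q + 3 := by
        push_cast; nlinarith
      rcases le_total 0 (⌊q * (u + l) + 1 / (N : ℝ)⌋ + 1 - ⌈q * u - 1 / (N : ℝ)⌉) with h | h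
      · rw [← Int.toNat_of_nonneg h] at h4
        exact_mod_cast h4
      · rw [Int.toNat_of_nonpos h]; push_cast; positivity
    refine (volume_le_card_mul (T := T) (f := fun p : ℤ => (p : ℝ) / q)
      (ρ := 1 / ((N : ℝ) * q)) ?_).trans ?_
    · rintro x ⟨hx, p, hp⟩
      refine ⟨p, ?_, hp⟩
      have e1 : (p : ℝ) = q * (p / q) := by field_simp
      have e2 : q * (1 / ((N : ℝ) * q)) = 1 / N := by field_simp
      rw [abs_le] at hp
      rw [hT, Finset.mem_Icc, Int.ceil_le, Int.le_floor, e1, ← e2]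
      constructor
      · rw [← mul_sub]; exact mul_le_mul_of_nonneg_left (by linarith [hx.1, hp.2]) hq0.le
      · rw [← mul_add]; exact mul_le_mul_of_nonneg_left (by linarith [hx.2, hp.1]) hq0.le
    · refine ENNReal.ofReal_le_ofReal ?_
      calc (T.card : ℝ) * (2 * (1 / ((N : ℝ) * q))) ≤ (l * q + 3) * (2 * (1 / ((N : ℝ) * q))) := by
            gcongr
        _ = _ := by field_simp; ring
  have hharm : ∑ i ∈ Finset.range (N / 16), ((i + 1 : ℕ) : ℝ)⁻¹ ≤ 1 + Real.log N := by
    have h1 : ∑ i ∈ Finset.range (N / 16), ((i + 1 : ℕ) : ℝ)⁻¹ ≤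
        ∑ i ∈ Finset.range N, ((i + 1 : ℕ) : ℝ)⁻¹ :=
      Finset.sum_le_sum_of_subset_of_nonneg (Finset.range_mono (Nat.div_le_self _ _))
        fun _ _ _ => by positivity
    have h2 := harmonic_le_one_add_log N
    rw [harmonic] at h2
    push_cast at h1 h2 ⊢
    linarith
  have hcnt : ((N / 16 : ℕ) : ℝ) ≤ N / 16 := by
    have := Nat.cast_div_le (α := ℝ) (m := N) (n := 16)
    simpa using this
  calc _ ≤ _ := measure_mono hcov
    _ ≤ ∑ i ∈ Finset.range (N / 16), volume (S i) := measure_biUnion_finset_le _ _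
    _ ≤ ∑ i ∈ Finset.range (N / 16), ENNReal.ofReal (2 * l / N + 6 / N * ((i + 1 : ℕ) : ℝ)⁻¹) :=
        Finset.sum_le_sum fun i _ => hSi i
    _ = ENNReal.ofReal (∑ i ∈ Finset.range (N / 16), (2 * l / N + 6 / N * ((i + 1 : ℕ) : ℝ)⁻¹)) :=
        (ENNReal.ofReal_sum_of_nonneg fun i _ => by positivity).symm
    _ ≤ _ := by
        refine ENNReal.ofReal_le_ofReal ?_
        rw [Finset.sum_add_distrib, ← Finset.mul_sum, Finset.sum_const, Finset.card_range,
          nsmul_eq_mul]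
        have e1 : ((N / 16 : ℕ) : ℝ) * (2 * l / N) ≤ N / 16 * (2 * l / N) := by gcongr
        have e2 : (N : ℝ) / 16 * (2 * l / N) = l / 8 := by field_simp; ring
        have e3 : 6 / (N : ℝ) * ∑ i ∈ Finset.range (N / 16), ((i + 1 : ℕ) : ℝ)⁻¹ ≤
          6 / N * (1 + Real.log N) := by gcongr
        have e4 : 6 / (N : ℝ) * (1 + Real.log N) = 6 * (1 + Real.log N) / N := by ring
        linarith

/-- Many rationals with denominators of size about `N` are close to points of an interval that
stay away from all rationals with denominators at least `B`. -/
lemma exists_finset_near_good {τ K u l B : ℝ} (hl : 0 < l)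
    (hbad : volume {x | x ∈ Set.Icc u (u + l) ∧ ∃ (b : ℕ) (a : ℤ), B ≤ b ∧
        |x - (a : ℝ) / b| < 2 * (b : ℝ) ^ (-τ)} ≤ ENNReal.ofReal K) (hK : K ≤ l / 4)
    {N : ℕ} (hN : 0 < N) (hNl : 6 * (1 + Real.log N) / N ≤ l / 4) :
    ∃ F : Finset ℚ, l * (N : ℝ) ^ 2 / 128 ≤ F.card ∧ ∀ r ∈ F, r.den ≤ N ∧ N < 16 * r.den ∧
      ∃ y ∈ Set.Icc u (u + l), |y - r| ≤ 16 / (N : ℝ) ^ 2 ∧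
        ∀ (b : ℕ) (a : ℤ), B ≤ b → 2 * (b : ℝ) ^ (-τ) ≤ |y - (a : ℝ) / b| := by
  have hN0 : (0 : ℝ) < N := by exact_mod_cast hN
  set ρ : ℝ := 16 / (N : ℝ) ^ 2 with hρ
  have hρ0 : 0 < ρ := by positivity
  set T : Set ℚ := {r | r.den ≤ N ∧ N < 16 * r.den ∧
      ∃ y ∈ Set.Icc u (u + l), |y - r| ≤ ρ ∧
        ∀ (b : ℕ) (a : ℤ), B ≤ b → 2 * (b : ℝ) ^ (-τ) ≤ |y - (a : ℝ) / b|} with hT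
  have hfin : T.Finite := by
    refine (finite_setOf_den_le hN (u - ρ) (l := l + 2 * ρ) (by positivity)).subset ?_
    rintro r ⟨hr, -, y, hy, hyr, -⟩
    rw [abs_le] at hyr
    exact ⟨hr, by linarith [hy.1, hyr.2], by linarith [hy.2, hyr.1]⟩
  refine ⟨hfin.toFinset, ?_, fun r hr => hfin.mem_toFinset.1 hr⟩
  set S₁ := {x | x ∈ Set.Icc u (u + l) ∧ ∃ (b : ℕ) (a : ℤ), B ≤ b ∧
        |x - (a : ℝ) / b| < 2 * (b : ℝ) ^ (-τ)} with hS₁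
  set S₂ := {x | x ∈ Set.Icc u (u + l) ∧ ∃ r : ℚ, 16 * r.den ≤ N ∧
      |x - r| ≤ 1 / ((N : ℝ) * r.den)} with hS₂
  set S₃ := {x : ℝ | ∃ r ∈ hfin.toFinset, |x - ((r : ℚ) : ℝ)| ≤ ρ} with hS₃
  -- By Dirichlet's theorem a point outside the two exceptional sets is approximated by a rational
  -- counted in `T`: its denominator exceeds `N / 16`, so the error `1 / (N * r.den)` is at most `16
  -- / N ^ 2`.
  have hcov : Set.Icc u (u + l) ⊆ S₁ ∪ S₂ ∪ S₃ := by
    intro x hx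
    by_contra hnot
    simp only [Set.mem_union, not_or] at hnot
    obtain ⟨⟨h1, h2⟩, h3⟩ := hnot
    obtain ⟨r, hxr, hrN⟩ := Real.exists_rat_abs_sub_le_and_den_le x hN
    have hd : (0 : ℝ) < r.den := by exact_mod_cast r.den_pos
    have hxr' : |x - r| ≤ 1 / ((N : ℝ) * r.den) := hxr.trans (by gcongr; linarith)
    have h16 : N < 16 * r.den := by
      by_contra! h
      exact h2 ⟨hx, r, h, hxr'⟩
    have h16' : (N : ℝ) ≤ 16 * r.den := by exact_mod_cast h16.le
    have hxρ : |x - r| ≤ ρ := by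
      refine hxr'.trans ?_
      rw [hρ, div_le_div_iff₀ (by positivity) (by positivity)]
      nlinarith
    refine h3 ⟨r, (Set.Finite.mem_toFinset _).2 ⟨hrN, h16, x, hx, hxρ, fun b a hb => ?_⟩, hxρ⟩
    by_contra! h
    exact h1 ⟨hx, b, a, hb, h⟩
  have hvol : ENNReal.ofReal l ≤ ENNReal.ofReal (l / 4) + ENNReal.ofReal (l / 8 + l / 4) +
      ENNReal.ofReal (hfin.toFinset.card * (2 * ρ)) := by
    calc ENNReal.ofReal l = volume (Set.Icc u (u + l)) := by rw [Real.volume_Icc]; congr 1; ring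
      _ ≤ volume (S₁ ∪ S₂ ∪ S₃) := measure_mono hcov
      _ ≤ volume S₁ + volume S₂ + volume S₃ :=
          (measure_union_le _ _).trans (by gcongr; exact measure_union_le _ _)
      _ ≤ _ := by
          gcongr
          · exact hbad.trans (ENNReal.ofReal_le_ofReal hK)
          · exact (volume_small_den_le u hl.le hN).trans
              (ENNReal.ofReal_le_ofReal (by linarith))
          · exact volume_le_card_mul fun x hx => hx
  rw [← ENNReal.ofReal_add (by positivity) (by positivity),
    ← ENNReal.ofReal_add (by positivity) (by positivity),
    ENNReal.ofReal_le_ofReal_iff (by positivity)] at hvol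
  -- The exceptional sets have measure at most `5 l / 8`, so balls of diameter `32 / N ^ 2` must
  -- cover at least `l / 4`.
  have h1 : l / 4 ≤ hfin.toFinset.card * (2 * ρ) := by linarith
  rw [hρ] at h1
  have h2 : (hfin.toFinset.card : ℝ) * (2 * (16 / (N : ℝ) ^ 2)) =
      32 * hfin.toFinset.card / (N : ℝ) ^ 2 := by ring
  rw [h2, le_div_iff₀ (by positivity)] at h1
  linarith

/-! ### Children of an interval -/

/-- Asymptotic inequalities for the scale `N` of the denominators of a new generation. -/
lemma eventually_scale {τ : ℝ} (hτ : 2 < τ) : ∀ᶠ N : ℕ in atTop,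
    (16 * (N : ℝ)⁻¹) ^ τ ≤ 1 / (2 * (N : ℝ) ^ 2) ∧ 2 ≤ ((N : ℝ) / 16) ^ (τ - 2) ∧
      2 * (N : ℝ) ≤ ((N : ℝ) ^ 2 / 32) ^ ((τ - 1) / τ) := by
  have hcast := tendsto_natCast_atTop_atTop (R := ℝ)
  have hτ0 : 0 < τ := by linarith
  have h1 : ∀ᶠ x : ℝ in atTop, 2 * (16 : ℝ) ^ τ ≤ x ^ (τ - 2) :=
    (tendsto_rpow_atTop (by linarith)).eventually_ge_atTop _
  have h2 : ∀ᶠ x : ℝ in atTop, 2 ≤ (x / 16) ^ (τ - 2) :=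
    ((tendsto_rpow_atTop (by linarith)).comp
      (tendsto_id.atTop_div_const (by norm_num : (0 : ℝ) < 16))).eventually_ge_atTop _
  have hexp : 0 < 2 * ((τ - 1) / τ) - 1 := by
    rw [sub_pos, mul_div_assoc', lt_div_iff₀ hτ0]; linarith
  have h3 : ∀ᶠ x : ℝ in atTop, 2 * (32 : ℝ) ^ ((τ - 1) / τ) ≤ x ^ (2 * ((τ - 1) / τ) - 1) :=
    (tendsto_rpow_atTop hexp).eventually_ge_atTop _
  filter_upwards [hcast.eventually h1, hcast.eventually h2, hcast.eventually h3,
    eventually_gt_atTop 0] with N e1 e2 e3 hN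
  have hN0 : (0 : ℝ) < N := by exact_mod_cast hN
  refine ⟨?_, e2, ?_⟩
  · rw [Real.mul_rpow (by norm_num) (by positivity), Real.inv_rpow hN0.le, ← div_eq_mul_inv,
      div_le_div_iff₀ (by positivity) (by positivity)]
    rw [Real.rpow_sub hN0, Real.rpow_two, le_div_iff₀ (by positivity)] at e1
    linarith
  · rw [Real.div_rpow (by positivity) (by norm_num), le_div_iff₀ (by positivity), ← Real.rpow_two,
      ← Real.rpow_mul hN0.le]
    rw [Real.rpow_sub hN0, Real.rpow_one, le_div_iff₀ hN0] at e3
    linarith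

lemma eventually_log_le {δ : ℝ} (hδ : 0 < δ) :
    ∀ᶠ N : ℕ in atTop, 6 * (1 + Real.log N) / N ≤ δ := by
  have h1 : Tendsto (fun x : ℝ => 6 * (1 / x + Real.log x / x)) atTop (𝓝 (6 * (0 + 0))) := by
    refine Tendsto.const_mul _ (Tendsto.add ?_ ?_)
    · exact tendsto_inv_atTop_zero.congr fun x => (one_div x).symm
    · exact Real.isLittleO_log_id_atTop.tendsto_div_nhds_zero
  have h2 := (h1.comp (tendsto_natCast_atTop_atTop (R := ℝ))).eventually_le_const
    (show 6 * ((0 : ℝ) + 0) < δ by simpa using hδ)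
  filter_upwards [h2] with N hN
  simp only [Function.comp] at hN
  rw [← add_div, mul_div_assoc'] at hN
  exact hN

/-- The interval attached to a rational number in the Cantor construction. -/
def nodeInterval (α β : ℕ → ℝ) (r : ℚ) : Set ℝ := Set.Icc (r + α r.den) (r + β r.den)

/-- The requirements on the intervals of the Cantor construction attached to rationals of
denominator `q`. -/
structure GoodDen (τ σ κ K : ℝ) (ω : ℝ → ℝ) (α β B : ℕ → ℝ) (q : ℕ) : Prop where
  omega_nonneg : 0 ≤ ω q
  left_nonneg : 0 ≤ α q
  right_le : β q ≤ (q : ℝ) ^ (-τ)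
  length_ge : κ * (q : ℝ) ^ (-σ) ≤ β q - α q
  one_le : 1 ≤ B q
  bad_le : K * ((β q - α q) / 2 * B q ^ (2 - τ) + B q ^ (-τ)) ≤ (β q - α q) / 2 / 4
  far : ∀ r : ℚ, r.den = q → ∀ x ∈ nodeInterval α β r, ∀ b : ℕ, q ≤ b → b ≤ B q →
    ∀ a : ℤ, (1 - ω b) * (b : ℝ) ^ (-τ) ≤ |x - (a : ℝ) / b|

section

variable {τ σ κ K : ℝ} {ω : ℝ → ℝ} {α β B : ℕ → ℝ}

/-- A point of a child interval is not too close to the rationals with denominators between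
those of the parent and of the child. -/
lemma far_of_near_good (hτ : 2 < τ) {r r' : ℚ} {N : ℕ}
    (hN : (16 * (N : ℝ)⁻¹) ^ τ ≤ 1 / (2 * (N : ℝ) ^ 2) ∧ 2 ≤ ((N : ℝ) / 16) ^ (τ - 2) ∧
      2 * (N : ℝ) ≤ ((N : ℝ) ^ 2 / 32) ^ ((τ - 1) / τ))
    (hr : GoodDen τ σ κ K ω α β B r.den) (hω : ∀ b : ℕ, r.den ≤ b → 0 ≤ ω b)
    (hr'N : r'.den ≤ N) (hNr' : N < 16 * r'.den)
    {y : ℝ} (hy : |y - r'| ≤ 16 / (N : ℝ) ^ 2)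
    (hgood : ∀ (b : ℕ) (a : ℤ), B r.den ≤ b → 2 * (b : ℝ) ^ (-τ) ≤ |y - (a : ℝ) / b|)
    {x : ℝ} (hx : x ∈ nodeInterval α β r) (hxr' : |x - r'| ≤ (r'.den : ℝ) ^ (-τ))
    {b : ℕ} (hb : r.den ≤ b) (hbr' : b < r'.den) (a : ℤ) :
    (1 - ω b) * (b : ℝ) ^ (-τ) ≤ |x - (a : ℝ) / b| := by
  obtain ⟨hN1, hN2, hN3⟩ := hN
  rcases le_total (b : ℝ) (B r.den) with hbB | hbB
  · exact hr.far r rfl x hx b hb hbB a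
  have hb0 : (0 : ℝ) < b := by exact_mod_cast lt_of_lt_of_le r.den_pos hb
  have hq0 : (0 : ℝ) < r'.den := by exact_mod_cast r'.den_pos
  have hqN : (r'.den : ℝ) ≤ N := by exact_mod_cast hr'N
  have hN0 : (0 : ℝ) < N := by linarith
  have hNq : (N : ℝ) ≤ 16 * r'.den := by exact_mod_cast hNr'.le
  have hbq : (b : ℝ) ≤ r'.den := by exact_mod_cast hbr'.le
  have hbτ : 0 < (b : ℝ) ^ (-τ) := by positivity
  suffices (b : ℝ) ^ (-τ) ≤ |x - (a : ℝ) / b| by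
    refine le_trans ?_ this
    nlinarith [hω b hb]
  -- If `b ^ (-τ)` dominates `|x - y| ≤ 32 / N ^ 2`, the margin `2 * b ^ (-τ)` at the good point `y`
  -- survives the passage to `x`. Otherwise `b` is so large that the gap `1 / (b * r'.den)` between
  -- `a / b` and `r'` suffices.
  rcases le_total (32 / (N : ℝ) ^ 2) ((b : ℝ) ^ (-τ)) with hcase | hcase
  · have h1 := hgood b a hbB
    have h2 : |x - r'| ≤ 16 / (N : ℝ) ^ 2 := by
      refine hxr'.trans ?_
      have e1 : (r'.den : ℝ) ^ (-τ) ≤ (16 * (N : ℝ)⁻¹) ^ τ := by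
        rw [Real.rpow_neg hq0.le, ← Real.inv_rpow hq0.le]
        refine Real.rpow_le_rpow (by positivity) ?_ (by linarith)
        rw [← div_eq_mul_inv, inv_le_comm₀ hq0 (by positivity), inv_div]
        linarith
      refine (e1.trans hN1).trans ?_
      rw [div_le_div_iff₀ (by positivity) (by positivity)]
      nlinarith [sq_nonneg (N : ℝ)]
    have h3 : 32 / (N : ℝ) ^ 2 = 16 / (N : ℝ) ^ 2 + 16 / (N : ℝ) ^ 2 := by ring
    have t1 : |y - (a : ℝ) / b| ≤ |y - r'| + |x - r'| + |x - (a : ℝ) / b| := by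
      calc |y - (a : ℝ) / b| = |(y - r') - (x - r') + (x - (a : ℝ) / b)| := by congr 1; ring
        _ ≤ |(y - r') - (x - r')| + |x - (a : ℝ) / b| := abs_add_le _ _
        _ ≤ _ := by gcongr; exact abs_sub _ _
    linarith
  · have hne : (a : ℝ) / b ≠ (r'.num : ℝ) / r'.den := by
      intro h
      rw [← Rat.cast_def] at h
      have := Nat.le_of_dvd (by exact_mod_cast hb0) (den_dvd_of_div_eq h)
      omega
    have h1 := one_div_mul_le_abs_div_sub_div (by exact_mod_cast hb0) r'.den_pos hne
    rw [← Rat.cast_def] at h1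
    have h2 : (r'.den : ℝ) ^ (-τ) ≤ 1 / (2 * (b * r'.den)) := by
      have e1 : 2 ≤ (r'.den : ℝ) ^ (τ - 2) := hN2.trans
        (Real.rpow_le_rpow (by positivity) (by linarith) (by linarith))
      rw [Real.rpow_sub hq0, Real.rpow_two, le_div_iff₀ (by positivity)] at e1
      rw [Real.rpow_neg hq0.le, ← one_div]
      refine one_div_le_one_div_of_le (by positivity) ?_
      nlinarith
    have h3 : (b : ℝ) ^ (-τ) ≤ 1 / (2 * (b * r'.den)) := by
      have e1 : (N : ℝ) ^ 2 / 32 ≤ (b : ℝ) ^ τ := by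
        rw [Real.rpow_neg hb0.le, ← one_div, div_le_div_iff₀ (by positivity) (by positivity)]
          at hcase
        linarith
      have e2 : ((N : ℝ) ^ 2 / 32) ^ ((τ - 1) / τ) ≤ (b : ℝ) ^ (τ - 1) := by
        calc _ ≤ ((b : ℝ) ^ τ) ^ ((τ - 1) / τ) :=
              Real.rpow_le_rpow (by positivity) e1 (div_nonneg (by linarith) (by linarith))
          _ = _ := by rw [← Real.rpow_mul hb0.le, mul_div_cancel₀ _ (by linarith)]
      have e3 := hN3.trans e2
      rw [Real.rpow_sub hb0, Real.rpow_one, le_div_iff₀ hb0] at e3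
      rw [Real.rpow_neg hb0.le, ← one_div]
      refine one_div_le_one_div_of_le (by positivity) ?_
      nlinarith
    have h4 : 1 / ((b : ℝ) * r'.den) = 1 / (2 * (b * r'.den)) + 1 / (2 * (b * r'.den)) := by
      field_simp; norm_num
    have t1 := abs_sub_le ((a : ℝ) / b) x r'
    rw [abs_sub_comm ((a : ℝ) / b) x] at t1
    linarith

/-- Every interval of the construction has many children of any given large scale. -/
lemma eventually_exists_children (hτ : 2 < τ)
    (hK : ∀ (u l B : ℝ), 0 ≤ l → 1 ≤ B →
      volume {x | x ∈ Set.Icc u (u + l) ∧ ∃ (b : ℕ) (a : ℤ), B ≤ b ∧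
        |x - (a : ℝ) / b| < 2 * (b : ℝ) ^ (-τ)}
      ≤ ENNReal.ofReal (K * (l * B ^ (2 - τ) + B ^ (-τ))))
    {q₀ : ℕ} (hq₀ : ∀ q, q₀ ≤ q → GoodDen τ σ κ K ω α β B q) {L : ℝ} (hL : 0 < L) :
    ∀ᶠ N : ℕ in atTop, ∀ r : ℚ, q₀ ≤ r.den → L ≤ β r.den - α r.den →
      ∀ m : ℕ, m ≤ L * (N : ℝ) ^ 2 / 256 → ∃ f : Fin m → ℚ, StrictMono f ∧
        ∀ i, (f i).den ≤ N ∧ N < 16 * (f i).den ∧ q₀ ≤ (f i).den ∧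
          nodeInterval α β (f i) ⊆ nodeInterval α β r ∧
          (∀ x ∈ nodeInterval α β (f i), (f i : ℝ) ≤ x ∧ x ≤ f i + 1 / (2 * (N : ℝ) ^ 2)) ∧
          ∀ x ∈ nodeInterval α β (f i), ∀ b : ℕ, r.den ≤ b → b < (f i).den → ∀ a : ℤ,
            (1 - ω b) * (b : ℝ) ^ (-τ) ≤ |x - (a : ℝ) / b| := by
  have hsq : ∀ᶠ N : ℕ in atTop, 32 / (N : ℝ) ^ 2 ≤ L / 4 := by
    have : Tendsto (fun N : ℕ => 32 / (N : ℝ) ^ 2) atTop (𝓝 0) :=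
      tendsto_const_nhds.div_atTop
        ((tendsto_pow_atTop two_ne_zero).comp tendsto_natCast_atTop_atTop)
    exact this.eventually_le_const (by positivity)
  filter_upwards [eventually_scale hτ, eventually_log_le (show 0 < L / 8 by positivity), hsq,
    eventually_ge_atTop (16 * q₀ + 1)] with N hN hlog hN32 hNq₀ r hr hLr m hm
  have hN0 : (0 : ℝ) < N := by exact_mod_cast (show 0 < N by omega)
  have hgr := hq₀ _ hr
  set l := β r.den - α r.den with hl
  -- Good points are sought in the middle half of the interval: a child lies within `32 / N ^ 2 ≤ l
  -- / 4` of its good point and so stays inside the parent.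
  obtain ⟨F, hFc, hF⟩ := exists_finset_near_good (u := r + α r.den + l / 4) (l := l / 2)
    (by linarith) (hK _ _ _ (by linarith) hgr.one_le) hgr.bad_le (N := N) (by omega)
    (hlog.trans (by linarith))
  have hmF : m ≤ F.card := by
    have : (m : ℝ) ≤ F.card := by
      refine hm.trans (le_trans ?_ hFc)
      rw [div_le_div_iff₀ (by norm_num) (by norm_num)]
      nlinarith [sq_nonneg (N : ℝ)]
    exact_mod_cast this
  refine ⟨F.orderEmbOfCardLe hmF, (F.orderEmbOfCardLe hmF).strictMono, fun i => ?_⟩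
  obtain ⟨h1, h2, y, hy, hyr, hgood⟩ := hF _ (F.orderEmbOfCardLe_mem hmF i)
  set r' := F.orderEmbOfCardLe hmF i
  have hr'q : q₀ ≤ r'.den := by omega
  have hgr' := hq₀ _ hr'q
  have hq0 : (0 : ℝ) < r'.den := by exact_mod_cast r'.den_pos
  have hNq : (N : ℝ) ≤ 16 * r'.den := by exact_mod_cast h2.le
  have e1 : (r'.den : ℝ) ^ (-τ) ≤ (16 * (N : ℝ)⁻¹) ^ τ := by
    rw [Real.rpow_neg hq0.le, ← Real.inv_rpow hq0.le]
    refine Real.rpow_le_rpow (by positivity) ?_ (by linarith)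
    rw [← div_eq_mul_inv, inv_le_comm₀ hq0 (by positivity), inv_div]
    linarith
  have e2 := e1.trans hN.1
  have e3 : 1 / (2 * (N : ℝ) ^ 2) ≤ 16 / (N : ℝ) ^ 2 := by
    rw [div_le_div_iff₀ (by positivity) (by positivity)]; nlinarith [sq_nonneg (N : ℝ)]
  have e4 : 32 / (N : ℝ) ^ 2 = 16 / (N : ℝ) ^ 2 + 16 / (N : ℝ) ^ 2 := by ring
  have hnear : ∀ x ∈ nodeInterval α β r', (r' : ℝ) ≤ x ∧ x ≤ r' + (r'.den : ℝ) ^ (-τ) :=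
    fun x hx => ⟨by linarith [hx.1, hgr'.left_nonneg], by linarith [hx.2, hgr'.right_le]⟩
  have hsub : nodeInterval α β r' ⊆ nodeInterval α β r := by
    intro x hx
    have := hnear x hx
    rw [abs_le] at hyr
    exact ⟨by linarith [hy.1, hyr.2], by linarith [hy.2, hyr.1]⟩
  refine ⟨h1, h2, hr'q, hsub, fun x hx => ⟨(hnear x hx).1, by linarith [(hnear x hx).2]⟩,
    fun x hx b hb hbr' a => ?_⟩
  refine far_of_near_good hτ hN hgr (fun b hb => (hq₀ b (hr.trans hb)).omega_nonneg) h1 h2 hyr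
    hgood (hsub hx) ?_ hb hbr' a
  rw [abs_le]
  have := hnear x hx
  constructor <;> linarith [Real.rpow_nonneg hq0.le (-τ)]

end

/-! ### Generations and the Cantor set -/

/-- A generation of the Cantor construction: a bound `N` for the denominators, the number `M` of
intervals, the number `m` of children of each interval of the previous generation, and an
enumeration of the centres of the intervals. -/
structure Generation where
  N : ℕ
  M : ℕ
  m : ℕ
  node : ℕ → ℚ

/-- The invariant of the Cantor construction. -/
structure Generation.Valid (q₀ : ℕ) (σ s c C : ℝ) (S : Generation) : Prop where
  N_pos : 0 < S.N
  M_pos : 0 < S.M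
  le_den : ∀ a, q₀ ≤ (S.node a).den
  den_le : ∀ a, (S.node a).den ≤ S.N
  dim : 2 / (S.M : ℝ) ≤ C * (c * (S.N : ℝ) ^ (-σ)) ^ s

/-- The relation between consecutive generations of the Cantor construction. -/
structure Generation.Next (τ σ c : ℝ) (ω : ℝ → ℝ) (α β : ℕ → ℝ) (S S' : Generation) :
    Prop where
  M_eq : S'.M = S.M * S'.m
  two_le : 2 ≤ S'.m
  N_lt : S.N < S'.N
  N_lt_den : ∀ a, S'.N < 16 * (S'.node a).den
  sub : ∀ a, nodeInterval α β (S'.node a) ⊆ nodeInterval α β (S.node (a / S'.m))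
  far : ∀ a, ∀ x ∈ nodeInterval α β (S'.node a), ∀ b : ℕ, (S.node (a / S'.m)).den ≤ b →
    b < (S'.node a).den → ∀ p : ℤ, (1 - ω b) * (b : ℝ) ^ (-τ) ≤ |x - (p : ℝ) / b|
  sep : ∀ a a', a / S'.m = a' / S'.m → ∀ x ∈ nodeInterval α β (S'.node a),
    ∀ y ∈ nodeInterval α β (S'.node a'), |(a : ℝ) - a'| * (1 / (2 * (S'.N : ℝ) ^ 2)) ≤ |x - y|
  gap : c * (S.N : ℝ) ^ (-σ) ≤ S'.m * (1 / (2 * (S'.N : ℝ) ^ 2))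

section

variable {τ σ κ K : ℝ} {ω : ℝ → ℝ} {α β B : ℕ → ℝ}

/-- Centres are spaced by `1 / N ^ 2` and each interval extends at most half of that to the right of
its centre, so half of the spacing remains. -/
lemma separation_of_strictMono {m N : ℕ} (hN : 0 < N) {f : Fin m → ℚ} (hf : StrictMono f)
    (hden : ∀ i, (f i).den ≤ N)
    (hnear : ∀ i, ∀ x ∈ nodeInterval α β (f i), (f i : ℝ) ≤ x ∧ x ≤ f i + 1 / (2 * (N : ℝ) ^ 2))
    (i j : Fin m) {x y : ℝ} (hx : x ∈ nodeInterval α β (f i)) (hy : y ∈ nodeInterval α β (f j)) :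
    |((i : ℕ) : ℝ) - (j : ℕ)| * (1 / (2 * (N : ℝ) ^ 2)) ≤ |x - y| := by
  wlog hij : i ≤ j generalizing i j x y with H
  · rw [abs_sub_comm, abs_sub_comm x y]
    exact H j i hy hx (le_of_not_ge hij)
  rcases hij.eq_or_lt with rfl | hlt
  · simp
  have hN0 : (0 : ℝ) < N := by exact_mod_cast hN
  have h1 := sub_div_sq_le_of_strictMono hf hden hij
  have h2 := hnear i x hx
  have h3 := hnear j y hy
  have h4 : (1 : ℝ) ≤ ((j : ℕ) : ℝ) - (i : ℕ) := by
    have : ((i : ℕ) : ℝ) + 1 ≤ (j : ℕ) := by exact_mod_cast hlt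
    linarith
  rw [abs_sub_comm, abs_of_nonneg (by linarith), abs_sub_comm x y]
  refine le_trans ?_ (le_abs_self _)
  have h5 : (((j : ℕ) : ℝ) - (i : ℕ)) / (N : ℝ) ^ 2 =
      2 * ((((j : ℕ) : ℝ) - (i : ℕ)) * (1 / (2 * (N : ℝ) ^ 2))) := by field_simp
  have h6 : 1 * (1 / (2 * (N : ℝ) ^ 2)) ≤ (((j : ℕ) : ℝ) - (i : ℕ)) * (1 / (2 * (N : ℝ) ^ 2)) :=
    mul_le_mul_of_nonneg_right h4 (by positivity)
  linarith

lemma Generation.Valid.exists_next (hτ : 2 < τ) (hσ : 0 < σ) (hκ : 0 < κ)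
    (hK : ∀ (u l B : ℝ), 0 ≤ l → 1 ≤ B →
      volume {x | x ∈ Set.Icc u (u + l) ∧ ∃ (b : ℕ) (a : ℤ), B ≤ b ∧
        |x - (a : ℝ) / b| < 2 * (b : ℝ) ^ (-τ)}
      ≤ ENNReal.ofReal (K * (l * B ^ (2 - τ) + B ^ (-τ))))
    {q₀ : ℕ} (hq₀ : ∀ q, q₀ ≤ q → GoodDen τ σ κ K ω α β B q)
    {s C : ℝ} (hs : s * σ < 2) (hC : 0 < C) {S : Generation}
    (hS : S.Valid q₀ σ s (κ / 1024) C) :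
    ∃ S' : Generation, S'.Valid q₀ σ s (κ / 1024) C ∧ S.Next τ σ (κ / 1024) ω α β S' := by
  have hSN : (0 : ℝ) < S.N := by exact_mod_cast hS.N_pos
  have hSM : (0 : ℝ) < S.M := by exact_mod_cast hS.M_pos
  set L : ℝ := κ * (S.N : ℝ) ^ (-σ) with hL
  have hL0 : 0 < L := by positivity
  have hlen : ∀ a, L ≤ β (S.node a).den - α (S.node a).den := by
    intro a
    refine le_trans (mul_le_mul_of_nonneg_left ?_ hκ.le) (hq₀ _ (hS.le_den a)).length_ge
    exact Real.rpow_le_rpow_of_nonpos (by exact_mod_cast (S.node a).den_pos)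
      (by exact_mod_cast hS.den_le a) (by linarith)
  have hcast := tendsto_natCast_atTop_atTop (R := ℝ)
  have hlarge : ∀ᶠ N : ℕ in atTop, 2 ≤ L * (N : ℝ) ^ 2 / 256 :=
    ((((tendsto_pow_atTop two_ne_zero).comp hcast).const_mul_atTop hL0).atTop_div_const
      (by norm_num)).eventually_ge_atTop _
  -- The number of children grows like `N ^ 2`, while the invariant `dim` demands only `N ^ (s *
  -- σ)`; as `s * σ < 2`, a large `N` absorbs all constants of the previous generation.
  have hdim : ∀ᶠ N : ℕ in atTop,
      2 / ((S.M : ℝ) * (L / 512)) / (C * (κ / 1024) ^ s) ≤ (N : ℝ) ^ (2 - s * σ) :=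
    ((tendsto_rpow_atTop (by linarith)).comp hcast).eventually_ge_atTop _
  obtain ⟨N, hch, hNlarge, hNdim, hNS⟩ := ((eventually_exists_children hτ hK hq₀ hL0).and
    (hlarge.and (hdim.and (eventually_gt_atTop S.N)))).exists
  have hN : 0 < N := by omega
  have hN0 : (0 : ℝ) < N := by exact_mod_cast hN
  -- `L` bounds all lengths of the generation from below, so every interval receives the same number
  -- of children. The `256` is the `128` of `exists_finset_near_good` applied to half an interval.
  set m := ⌊L * (N : ℝ) ^ 2 / 256⌋₊ with hm
  have hm2 : 2 ≤ m := Nat.le_floor (by exact_mod_cast hNlarge)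
  have hmlow : L / 512 * (N : ℝ) ^ 2 ≤ m := by
    have := Nat.lt_floor_add_one (L * (N : ℝ) ^ 2 / 256)
    rw [← hm] at this
    linarith
  have hm0 : (0 : ℝ) < m := by exact_mod_cast (show 0 < m by omega)
  choose f hfmono hf using fun a => hch (S.node a) (hS.le_den a) (hlen a) m
    (Nat.floor_le (by positivity))
  have hlt : ∀ a, a % m < m := fun a => Nat.mod_lt _ (by omega)
  refine ⟨⟨N, S.M * m, m, fun a => f (a / m) ⟨a % m, hlt a⟩⟩, ⟨hN,
    Nat.mul_pos hS.M_pos (by omega), fun a => (hf _ _).2.2.1, fun a => (hf _ _).1, ?_⟩,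
    ⟨rfl, hm2, hNS, fun a => (hf _ _).2.1, fun a => (hf _ _).2.2.2.1,
      fun a => (hf _ _).2.2.2.2.2, ?_, ?_⟩⟩
  · dsimp only
    rw [div_le_iff₀ (by positivity), Real.rpow_sub hN0, Real.rpow_two,
      div_mul_eq_mul_div, le_div_iff₀ (by positivity)] at hNdim
    rw [Real.mul_rpow (by positivity) (by positivity), ← Real.rpow_mul hN0.le, neg_mul,
      mul_comm σ s, Real.rpow_neg hN0.le, ← mul_assoc, ← div_eq_mul_inv,
      le_div_iff₀ (by positivity)]
    calc 2 / (((S.M * m : ℕ)) : ℝ) * (N : ℝ) ^ (s * σ)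
        ≤ 2 / ((S.M : ℝ) * (L / 512 * (N : ℝ) ^ 2)) * (N : ℝ) ^ (s * σ) := by
          push_cast; gcongr
      _ = 2 / ((S.M : ℝ) * (L / 512)) * (N : ℝ) ^ (s * σ) / (N : ℝ) ^ 2 := by field_simp
      _ ≤ C * (κ / 1024) ^ s := by
          rw [div_le_iff₀ (by positivity)]
          linarith
  · intro a a' haa x hx y hy
    dsimp only at haa hx hy ⊢
    rw [← haa] at hy
    have h1 := separation_of_strictMono hN (hfmono (a / m)) (fun i => (hf _ i).1)
      (fun i => (hf _ i).2.2.2.2.1) _ _ hx hy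
    have e1 : (a : ℝ) = m * (a / m : ℕ) + (a % m : ℕ) := by exact_mod_cast (Nat.div_add_mod a m).symm
    have e2 : (a' : ℝ) = m * (a / m : ℕ) + (a' % m : ℕ) := by
      rw [haa]; exact_mod_cast (Nat.div_add_mod a' m).symm
    rw [e1, e2, add_sub_add_left_eq_sub]
    exact h1
  · dsimp only
    rw [mul_one_div, le_div_iff₀ (by positivity)]
    calc _ = L / 512 * (N : ℝ) ^ 2 := by rw [hL]; ring
      _ ≤ m := hmlow

/-- The lower bound for the Hausdorff dimension of the points of exact order, from intervals near
each rational number that avoid the rational numbers of moderate denominators. -/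
theorem le_dimH_exactOrder (hτ : 2 < τ) (hσ : 2 < σ) (hκ : 0 < κ)
    (hω : ∀ᶠ q : ℕ in atTop, 0 ≤ ω q) (hα : ∀ᶠ q : ℕ in atTop, 0 ≤ α q)
    (hβ : ∀ᶠ q : ℕ in atTop, β q ≤ (q : ℝ) ^ (-τ))
    (hlen : ∀ᶠ q : ℕ in atTop, κ * (q : ℝ) ^ (-σ) ≤ β q - α q)
    (hB : Tendsto B atTop atTop)
    (hBσ : Tendsto (fun q : ℕ => B q ^ (-τ) * (q : ℝ) ^ σ) atTop (𝓝 0))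
    (hJ : ∀ᶠ q : ℕ in atTop, ∀ r : ℚ, r.den = q → ∀ x ∈ Set.Icc (r + α q) (r + β q), ∀ b : ℕ,
      q ≤ b → b ≤ B q → ∀ a : ℤ, (1 - ω b) * (b : ℝ) ^ (-τ) ≤ |x - (a : ℝ) / b|) :
    ENNReal.ofReal (2 / σ) ≤ dimH (exactOrder (fun q : ℝ => q ^ (-τ)) ω) := by
  obtain ⟨K, hK0, hK⟩ := exists_volume_bad_le hτ
  have hgood : ∀ᶠ q : ℕ in atTop, GoodDen τ σ κ K ω α β B q := by
    have h1 : Tendsto (fun q => B q ^ (-(τ - 2))) atTop (𝓝 0) :=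
      (tendsto_rpow_neg_atTop (by linarith)).comp hB
    filter_upwards [hω, hα, hβ, hlen, hB.eventually_ge_atTop 1, hJ, eventually_gt_atTop 0,
      h1.eventually_le_const (show (0 : ℝ) < 1 / (8 * K) by positivity),
      hBσ.eventually_le_const (show (0 : ℝ) < κ / (16 * K) by positivity)]
      with q e1 e2 e3 e4 e5 e6 e7 e8 e9
    have hq0 : (0 : ℝ) < q := by exact_mod_cast e7
    refine ⟨e1, e2, e3, e4, e5, ?_, ?_⟩
    · rw [neg_sub] at e8
      rw [le_div_iff₀ (by positivity)] at e8 e9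
      have h2 : 0 ≤ β q - α q := le_trans (by positivity) e4
      have h3 : B q ^ (-τ) * (16 * K) ≤ κ * (q : ℝ) ^ (-σ) := by
        rw [Real.rpow_neg hq0.le σ, ← div_eq_mul_inv, le_div_iff₀ (by positivity)]
        linarith
      have h4 := mul_le_mul_of_nonneg_left e8 h2
      nlinarith
    · rintro r hr x hx
      rw [nodeInterval, hr] at hx
      exact e6 r hr x hx
  obtain ⟨q₁, hq₁⟩ := eventually_atTop.1 hgood
  set q₀ := q₁ + 1 with hq₀def
  have hq₀ : ∀ q, q₀ ≤ q → GoodDen τ σ κ K ω α β B q := fun q hq => hq₁ q (by omega)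
  refine ENNReal.le_of_forall_nnreal_lt fun s hs => ?_
  have hs' : (s : ℝ) < 2 / σ := by
    rwa [← ENNReal.ofReal_coe_nnreal, ENNReal.ofReal_lt_ofReal_iff_of_nonneg s.coe_nonneg] at hs
  rcases eq_or_lt_of_le s.coe_nonneg with hs0 | hs0
  · have : s = 0 := NNReal.eq hs0.symm
    rw [this]; exact bot_le
  have hsσ : (s : ℝ) * σ < 2 := by rwa [lt_div_iff₀ (by linarith)] at hs'
  have hs1 : (s : ℝ) ≤ 1 := by nlinarith
  have hq0 : (0 : ℝ) < q₀ := by rw [hq₀def]; positivity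
  -- `C` is chosen to give equality in the invariant `dim` at the initial generation, which has a
  -- single interval.
  obtain ⟨C, hC, hCeq⟩ : ∃ C : ℝ, 0 < C ∧ 2 = C * (κ / 1024 * (q₀ : ℝ) ^ (-σ)) ^ (s : ℝ) := by
    have : 0 < (κ / 1024 * (q₀ : ℝ) ^ (-σ)) ^ (s : ℝ) := by positivity
    exact ⟨2 / (κ / 1024 * (q₀ : ℝ) ^ (-σ)) ^ (s : ℝ), by positivity, by field_simp⟩
  let V := {S : Generation // S.Valid q₀ σ s (κ / 1024) C}
  have hstep : ∀ S : V, ∃ S' : V, S.1.Next τ σ (κ / 1024) ω α β S'.1 := fun S => by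
    obtain ⟨S', h1, h2⟩ := S.2.exists_next hτ (by linarith) hκ hK hq₀ hsσ hC
    exact ⟨⟨S', h1⟩, h2⟩
  choose next hnext using hstep
  have hden0 : ((q₀ : ℚ)⁻¹).den = q₀ := Rat.inv_natCast_den_of_pos (by omega)
  let S₀ : V := ⟨⟨q₀, 1, 2, fun _ => (q₀ : ℚ)⁻¹⟩, by simp [hq₀def], one_pos,
    fun _ => hden0.ge, fun _ => hden0.le, by
      simp only [Nat.cast_one, div_one]; exact hCeq.le⟩
  let S : ℕ → V := fun k => Nat.rec S₀ (fun _ T => next T) k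
  have hS : ∀ k, (S k).1.Next τ σ (κ / 1024) ω α β (S (k + 1)).1 := fun k => hnext (S k)
  have hNk : ∀ k, k ≤ (S k).1.N := by
    intro k
    induction k with
    | zero => exact Nat.zero_le _
    | succ k ih => exact lt_of_le_of_lt ih (hS k).N_lt
  rw [← ENNReal.ofReal_coe_nnreal]
  refine le_dimH_of_cantor_scheme (C := C) hs0 hs1 (m := fun k => (S (k + 1)).1.m)
    (M := fun k => (S k).1.M) rfl (fun k => (hS k).M_eq) (fun k => (hS k).two_le)
    (I := fun k a => nodeInterval α β ((S k).1.node a)) (fun k a => isCompact_Icc)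
    (fun k a => ?_) (fun k a => (hS k).sub a)
    (ε := fun k => 1 / (2 * ((S (k + 1)).1.N : ℝ) ^ 2)) (fun k => ?_) (fun k => (hS k).sep)
    (fun k => ?_) ?_
  · have hg := hq₀ _ ((S k).2.le_den a)
    refine Set.nonempty_Icc.2 ?_
    have h1 : 0 ≤ κ * ((((S k).1.node a).den : ℕ) : ℝ) ^ (-σ) := by positivity
    linarith [hg.length_ge]
  · have : (0 : ℝ) < (S (k + 1)).1.N := by exact_mod_cast (S (k + 1)).2.N_pos
    positivity
  · refine (S k).2.dim.trans (mul_le_mul_of_nonneg_left ?_ hC.le)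
    exact Real.rpow_le_rpow (by positivity) (hS k).gap hs0.le
  · intro a ha x hx
    set r : ℕ → ℚ := fun k => (S k).1.node (a k) with hr
    have hrden : ∀ k, k < 16 * (r (k + 1)).den := fun k =>
      lt_of_le_of_lt ((Nat.le_succ k).trans (hNk (k + 1))) ((hS k).N_lt_den _)
    have hclose : ∀ k, |x - r k| ≤ ((r k).den : ℝ) ^ (-τ) := by
      intro k
      have hg := hq₀ _ ((S k).2.le_den (a k))
      have h1 := hx k
      have h2 : (0 : ℝ) ≤ ((r k).den : ℝ) ^ (-τ) := by positivity
      rw [abs_le]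
      constructor <;> linarith [h1.1, h1.2, hg.left_nonneg, hg.right_le]
    refine ⟨fun hfin => ?_, ?_⟩
    · obtain ⟨Q, hQ⟩ := (hfin.image Prod.snd).bddAbove
      have h1 : (r (16 * Q + 1)).den ≤ Q := hQ ⟨((r (16 * Q + 1)).num, (r (16 * Q + 1)).den),
        ⟨(r (16 * Q + 1)).den_pos, by dsimp only; rw [← Rat.cast_def]; exact hclose (16 * Q + 1)⟩, rfl⟩
      have h2 := hrden (16 * Q)
      omega
    · filter_upwards [eventually_ge_atTop (r 0).den] with b hb p
      -- Every large `b` falls between the denominators of two consecutive centres, where the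
      -- child's `far` property applies.
      have hex : ∃ k, b < (r k).den := ⟨16 * b + 1, by have := hrden (16 * b); omega⟩
      classical
      obtain ⟨k, hk⟩ : ∃ k, Nat.find hex = k + 1 := by
        refine Nat.exists_eq_succ_of_ne_zero fun h0 => ?_
        have := Nat.find_spec hex
        rw [h0] at this
        omega
      have h1 : b < (r (k + 1)).den := hk ▸ Nat.find_spec hex
      have h2 : (r k).den ≤ b := by
        by_contra! h
        have := Nat.find_min' hex h
        omega
      refine (hS k).far (a (k + 1)) x (hx (k + 1)) b ?_ h1 p
      rw [← ha k]
      exact h2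

end

/-! ### Windows for power functions -/

lemma tendsto_rpow_div_rpow_mul {e D τ σ : ℝ} (hD : 0 < D) (h : σ < e * τ) :
    Tendsto (fun q : ℕ => ((q : ℝ) ^ e / D) ^ (-τ) * (q : ℝ) ^ σ) atTop (𝓝 0) := by
  have h1 : Tendsto (fun q : ℕ => D ^ τ * (q : ℝ) ^ (-(e * τ - σ))) atTop (𝓝 (D ^ τ * 0)) :=
    ((tendsto_rpow_neg_atTop (by linarith)).comp tendsto_natCast_atTop_atTop).const_mul _
  rw [mul_zero] at h1
  refine h1.congr' ?_
  filter_upwards [eventually_gt_atTop 0] with q hq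
  have hq0 : (0 : ℝ) < q := by exact_mod_cast hq
  rw [Real.div_rpow (by positivity) hD.le, ← Real.rpow_mul hq0.le, Real.rpow_neg hD.le,
    div_inv_eq_mul, mul_right_comm, ← Real.rpow_add hq0, mul_comm]
  congr 2
  ring

lemma tendsto_rpow_div_atTop {e D : ℝ} (he : 0 < e) (hD : 0 < D) :
    Tendsto (fun q : ℕ => (q : ℝ) ^ e / D) atTop atTop :=
  ((tendsto_rpow_atTop he).comp tendsto_natCast_atTop_atTop).atTop_div_const hD

lemma tendsto_const_mul_rpow_neg (A : ℝ) {τ₂ : ℝ} (h : 0 < τ₂) :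
    Tendsto (fun q : ℕ => A * (q : ℝ) ^ (-τ₂)) atTop (𝓝 0) := by
  simpa using ((tendsto_rpow_neg_atTop h).comp tendsto_natCast_atTop_atTop).const_mul A

/-- A point at the exact distance from `p / q` is not too close to the rationals with denominators
between `q` and `q ^ (τ - 1) / 2`. -/
lemma eventually_far {τ : ℝ} (hτ : 2 < τ) {ω : ℝ → ℝ} (hω : ∀ᶠ q : ℕ in atTop, 0 ≤ ω q)
    (hω0 : Tendsto (fun q : ℕ => ω q) atTop (𝓝 0)) :
    ∀ᶠ q : ℕ in atTop, ∀ r : ℚ, r.den = q → ∀ x : ℝ, (1 - ω q) * (q : ℝ) ^ (-τ) ≤ |x - r| →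
      |x - r| ≤ (q : ℝ) ^ (-τ) → ∀ b : ℕ, q ≤ b → (b : ℝ) ≤ (q : ℝ) ^ (τ - 1) / 2 → ∀ a : ℤ,
        (1 - ω b) * (b : ℝ) ^ (-τ) ≤ |x - (a : ℝ) / b| := by
  have h1 : ∀ᶠ q : ℕ in atTop, 2 ≤ (q : ℝ) ^ (τ - 2) :=
    ((tendsto_rpow_atTop (by linarith)).comp tendsto_natCast_atTop_atTop).eventually_ge_atTop _
  filter_upwards [eventually_forall_ge_atTop.2 hω, hω0.eventually_le_const (show (0 : ℝ) < 1 / 2 by norm_num),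
    h1, eventually_gt_atTop 0] with q e1 e2 e3 hq r hr x hx1 hx2 b hqb hbq a
  have hq0 : (0 : ℝ) < q := by exact_mod_cast hq
  have hqb' : (q : ℝ) ≤ b := by exact_mod_cast hqb
  have hb0 : (0 : ℝ) < b := by linarith
  have hbτ : 0 < (b : ℝ) ^ (-τ) := by positivity
  have hqτ : 0 < (q : ℝ) ^ (-τ) := by positivity
  have hle : (1 - ω b) * (b : ℝ) ^ (-τ) ≤ (b : ℝ) ^ (-τ) := by nlinarith [e1 b hqb]
  -- If `a / b = r`, then `b` is a multiple of `q`: for `b = q` the bound is the hypothesis, and for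
  -- `b ≥ 2 q` the target has dropped by a factor `2`. Otherwise the gap `1 / (b q)` is at least
  -- twice both `q ^ (-τ)` and `b ^ (-τ)`.
  by_cases heq : (a : ℝ) / b = r
  · rw [heq]
    refine le_trans ?_ hx1
    obtain ⟨k, hk⟩ := den_dvd_of_div_eq heq
    rw [hr] at hk
    rcases Nat.lt_or_ge k 2 with hk2 | hk2
    · have : b = q := by
        interval_cases k
        · omega
        · omega
      rw [this]
    · refine hle.trans ?_
      have h2 : 2 * (q : ℝ) ≤ b := by
        have : 2 * q ≤ b := by rw [hk]; nlinarith
        exact_mod_cast this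
      have h3 : (2 : ℝ) ^ (-τ) ≤ 1 / 2 := by
        have := Real.rpow_le_rpow_of_exponent_le (one_le_two (α := ℝ))
          (show -τ ≤ -1 by linarith)
        rwa [Real.rpow_neg_one, ← one_div] at this
      calc (b : ℝ) ^ (-τ) ≤ (2 * (q : ℝ)) ^ (-τ) :=
            Real.rpow_le_rpow_of_nonpos (by positivity) h2 (by linarith)
        _ = 2 ^ (-τ) * (q : ℝ) ^ (-τ) := Real.mul_rpow (by norm_num) hq0.le
        _ ≤ (1 - ω q) * (q : ℝ) ^ (-τ) := by gcongr; linarith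
  · refine hle.trans ?_
    have hne := heq
    rw [Rat.cast_def] at hne
    have h2 := one_div_mul_le_abs_div_sub_div (by omega) r.den_pos hne
    rw [← Rat.cast_def, hr] at h2
    have h3 : (q : ℝ) ^ (-τ) ≤ 1 / (2 * (b * q)) := by
      rw [Real.rpow_sub hq0, Real.rpow_one, div_div, le_div_iff₀ (by positivity)] at hbq
      rw [Real.rpow_neg hq0.le, ← one_div]
      exact one_div_le_one_div_of_le (by positivity) (by linarith)
    have h4 : (b : ℝ) ^ (-τ) ≤ 1 / (2 * (b * q)) := by
      have e4 : 2 ≤ (b : ℝ) ^ (τ - 2) :=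
        e3.trans (Real.rpow_le_rpow hq0.le hqb' (by linarith))
      rw [Real.rpow_sub hb0, Real.rpow_two, le_div_iff₀ (by positivity)] at e4
      rw [Real.rpow_neg hb0.le, ← one_div]
      refine one_div_le_one_div_of_le (by positivity) ?_
      nlinarith
    have h5 : 1 / ((b : ℝ) * q) = 1 / (2 * (b * q)) + 1 / (2 * (b * q)) := by
      field_simp; norm_num
    have t1 := abs_sub_le ((a : ℝ) / b) x r
    rw [abs_sub_comm ((a : ℝ) / b) x] at t1
    linarith

theorem le_dimH_exactOrder_rpow {τ τ₂ : ℝ} (hτ : 2 < τ) (h0 : 0 < τ₂) (h1 : τ₂ < τ * (τ - 2)) :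
    ENNReal.ofReal (2 / (τ + τ₂)) ≤
      dimH (exactOrder (fun q : ℝ => q ^ (-τ)) (fun q : ℝ => q ^ (-τ₂))) := by
  have hω : ∀ᶠ q : ℕ in atTop, 0 ≤ (q : ℝ) ^ (-τ₂) := Eventually.of_forall fun q => by positivity
  have hω0 : Tendsto (fun q : ℕ => (q : ℝ) ^ (-τ₂)) atTop (𝓝 0) := by
    simpa using tendsto_const_mul_rpow_neg 1 h0
  have hα : ∀ᶠ q : ℕ in atTop, 0 ≤ (1 - (q : ℝ) ^ (-τ₂)) * (q : ℝ) ^ (-τ) := by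
    filter_upwards [hω0.eventually_le_const one_pos] with q hq
    exact mul_nonneg (by linarith) (by positivity)
  refine le_dimH_exactOrder (κ := 1) (α := fun q => (1 - (q : ℝ) ^ (-τ₂)) * (q : ℝ) ^ (-τ))
    (β := fun q => (q : ℝ) ^ (-τ)) (B := fun q => (q : ℝ) ^ (τ - 1) / 2) hτ (by linarith) one_pos
    hω hα (Eventually.of_forall fun q => le_rfl) ?_
    (tendsto_rpow_div_atTop (by linarith) two_pos) (tendsto_rpow_div_rpow_mul two_pos ?_) ?_
  · filter_upwards [eventually_gt_atTop 0] with q hq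
    rw [neg_add_rev, Real.rpow_add (by exact_mod_cast hq)]
    linarith
  -- The condition `τ + τ₂ < (τ - 1) * τ` is exactly `τ₂ < τ * (τ - 2)`.
  · nlinarith
  · filter_upwards [hα, eventually_far (ω := fun q => q ^ (-τ₂)) hτ hω hω0] with q hq hfar r hr x hx
    have h2 : 0 ≤ x - r := by linarith [hx.1]
    refine hfar r hr x ?_ ?_ <;> rw [abs_of_nonneg h2] <;> linarith [hx.1, hx.2]

/-- For integral exponents the intervals may be much shorter. They only have to avoid the
neighbourhood of the rational number `p / q + 1 / q ^ n`. -/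
theorem le_dimH_exactOrder_natCast {n : ℕ} (hn : 3 ≤ n) {A τ₂ κ : ℝ} (hA : 0 < A) (hκ : 0 < κ)
    (hτ₂ : (n : ℝ) * ((n : ℝ) - 2) ≤ τ₂)
    (hlen : ∀ᶠ q : ℕ in atTop, κ * (q : ℝ) ^ (-((n : ℝ) + τ₂)) ≤
      A * (q : ℝ) ^ (-((n : ℝ) + τ₂)) - (q : ℝ) ^ (-((n : ℝ) * n))) :
    ENNReal.ofReal (2 / ((n : ℝ) + τ₂)) ≤
      dimH (exactOrder (fun q : ℝ => q ^ (-(n : ℝ))) (fun q : ℝ => A * q ^ (-τ₂))) := by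
  have hn' : (3 : ℝ) ≤ n := by exact_mod_cast hn
  have h0 : 0 < τ₂ := by nlinarith
  have hω : ∀ᶠ q : ℕ in atTop, 0 ≤ A * (q : ℝ) ^ (-τ₂) :=
    Eventually.of_forall fun q => by positivity
  have hω0 := tendsto_const_mul_rpow_neg A h0
  have hα : ∀ᶠ q : ℕ in atTop, 0 ≤ (1 - A * (q : ℝ) ^ (-τ₂)) * (q : ℝ) ^ (-(n : ℝ)) := by
    filter_upwards [hω0.eventually_le_const one_pos] with q hq
    exact mul_nonneg (by linarith) (by positivity)
  -- This holds because `(n - 1) ^ 2 > n` for `n ≥ 3`; it makes `b ^ (-n)` small against the gap `1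
  -- / (b * q ^ n)` once `b ≥ q ^ (n - 1) / 2`.
  have hbig : ∀ᶠ q : ℕ in atTop, 4 * (q : ℝ) ^ n ≤
      ((q : ℝ) ^ ((n : ℝ) - 1) / 2) ^ ((n : ℝ) - 1) := by
    have h1 : ∀ᶠ q : ℕ in atTop, 4 * 2 ^ ((n : ℝ) - 1) ≤
        (q : ℝ) ^ (((n : ℝ) - 1) * ((n : ℝ) - 1) - n) :=
      ((tendsto_rpow_atTop (by nlinarith)).comp
        tendsto_natCast_atTop_atTop).eventually_ge_atTop _
    filter_upwards [h1, eventually_gt_atTop 0] with q e1 hq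
    have hq0 : (0 : ℝ) < q := by exact_mod_cast hq
    rw [Real.rpow_sub hq0, le_div_iff₀ (by positivity), Real.rpow_natCast] at e1
    rw [Real.div_rpow (by positivity) (by norm_num), ← Real.rpow_mul hq0.le,
      le_div_iff₀ (by positivity)]
    linarith
  refine le_dimH_exactOrder (κ := κ)
    (α := fun q => (1 - A * (q : ℝ) ^ (-τ₂)) * (q : ℝ) ^ (-(n : ℝ)))
    (β := fun q => (q : ℝ) ^ (-(n : ℝ)) - (q : ℝ) ^ (-((n : ℝ) * n)))
    (B := fun q => (q : ℝ) ^ τ₂ / (4 * A)) (by linarith) (by linarith) hκ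
    hω hα (Eventually.of_forall fun q => sub_le_self _ (by positivity)) ?_
    (tendsto_rpow_div_atTop h0 (by positivity))
    (tendsto_rpow_div_rpow_mul (by positivity) ?_) ?_
  · filter_upwards [eventually_gt_atTop 0, hlen] with q hq hl
    refine hl.trans_eq ?_
    rw [neg_add_rev, Real.rpow_add (by exact_mod_cast hq)]
    ring
  · nlinarith [mul_nonneg (show (0 : ℝ) ≤ n - 3 by linarith) h0.le,
      mul_nonneg (show (0 : ℝ) ≤ n - 3 by linarith) (show (0 : ℝ) ≤ n by linarith)]
  · filter_upwards [hα, eventually_far (ω := fun q => A * q ^ (-τ₂))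
      (show (2 : ℝ) < n by linarith) hω hω0, hbig,
      eventually_gt_atTop 0] with q hq hfar hqbig hqpos r hr x hx b hqb hbB a
    have hq0 : (0 : ℝ) < q := by exact_mod_cast hqpos
    have h2 : 0 ≤ x - r := by linarith [hx.1]
    have hpos : 0 < (q : ℝ) ^ (-((n : ℝ) * n)) := by positivity
    rcases le_total (b : ℝ) ((q : ℝ) ^ ((n : ℝ) - 1) / 2) with hb | hb
    · refine hfar r hr x ?_ ?_ b hqb hb a <;> rw [abs_of_nonneg h2] <;> linarith [hx.1, hx.2]
    have hqb' : (q : ℝ) ≤ b := by exact_mod_cast hqb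
    have hb0 : (0 : ℝ) < b := by linarith
    have hbpos : 0 < b := by omega
    suffices (b : ℝ) ^ (-(n : ℝ)) ≤ |x - (a : ℝ) / b| by
      refine le_trans ?_ this
      have e1 : 0 < (b : ℝ) ^ (-(n : ℝ)) := by positivity
      have e2 : 0 ≤ A * (b : ℝ) ^ (-τ₂) := by positivity
      nlinarith
    -- `P` is congruent to `1` modulo `q`, so `P / q ^ n` is in lowest terms. A fraction `a / b`
    -- equal to it has `b ≥ q ^ n`, and the trimmed length `q ^ (-n²)` then suffices.
    set P : ℤ := 1 + q * (r.num * q ^ (n - 2)) with hP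
    have hPQ : (P : ℝ) / ((q ^ n : ℕ) : ℝ) = r + (q : ℝ) ^ (-(n : ℝ)) := by
      have e1 : (q : ℝ) ^ n = q ^ (n - 2) * q * q := by
        rw [← pow_succ, ← pow_succ]; congr 1; omega
      rw [Rat.cast_def r, hr, hP, Real.rpow_neg hq0.le, Real.rpow_natCast]
      push_cast
      rw [e1]
      field_simp
      ring
    by_cases heq : (a : ℝ) / b = (P : ℝ) / ((q ^ n : ℕ) : ℝ)
    · have hcop : IsCoprime ((q ^ n : ℕ) : ℤ) P := by
        rw [Nat.cast_pow]
        exact (isCoprime_one_right.add_mul_left_right _).pow_left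
      have hdvd : q ^ n ∣ b := by
        rw [div_eq_div_iff hb0.ne' (by positivity)] at heq
        have e1 : a * ((q ^ n : ℕ) : ℤ) = P * b := by exact_mod_cast heq
        exact Int.natCast_dvd_natCast.1 (hcop.dvd_of_dvd_mul_left ⟨a, by rw [← e1, mul_comm]⟩)
      have hle : ((q ^ n : ℕ) : ℝ) ≤ b := by exact_mod_cast Nat.le_of_dvd hbpos hdvd
      rw [heq, hPQ, abs_sub_comm]
      refine le_trans ?_ (le_abs_self _)
      calc (b : ℝ) ^ (-(n : ℝ)) ≤ ((q ^ n : ℕ) : ℝ) ^ (-(n : ℝ)) :=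
            Real.rpow_le_rpow_of_nonpos (by positivity) hle (by linarith)
        _ = (q : ℝ) ^ (-((n : ℝ) * n)) := by
            rw [Nat.cast_pow, ← Real.rpow_natCast, ← Real.rpow_mul hq0.le, mul_neg]
        _ ≤ _ := by linarith [hx.2]
    · have h3 := one_div_mul_le_abs_div_sub_div hbpos (pow_pos hqpos n) heq
      -- The point `x` lies within the window length `A * q ^ (-τ₂ - n)` of `P / q ^ n`; the choice
      -- `B q = q ^ τ₂ / (4 * A)` makes this at most a quarter of the gap.
      have h4 : |x - (P : ℝ) / ((q ^ n : ℕ) : ℝ)| ≤ 1 / (4 * (b * ((q ^ n : ℕ) : ℝ))) := by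
        have e1 : A * (q : ℝ) ^ (-τ₂) * (q : ℝ) ^ (-(n : ℝ)) ≤
            1 / (4 * (b * ((q ^ n : ℕ) : ℝ))) := by
          rw [le_div_iff₀ (by positivity)] at hbB
          rw [Real.rpow_neg hq0.le, Real.rpow_neg hq0.le, Real.rpow_natCast, Nat.cast_pow,
            le_div_iff₀ (by positivity)]
          have : A * ((q : ℝ) ^ τ₂)⁻¹ * ((q : ℝ) ^ n)⁻¹ * (4 * (b * (q : ℝ) ^ n)) =
              b * (4 * A) / (q : ℝ) ^ τ₂ := by field_simp
          rw [this]
          exact (div_le_one (by positivity)).2 hbB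
        refine le_trans ?_ e1
        rw [hPQ, abs_le]
        have e2 : 0 ≤ A * (q : ℝ) ^ (-τ₂) * (q : ℝ) ^ (-(n : ℝ)) := by positivity
        constructor <;> linarith [hx.1, hx.2]
      have h5 : (b : ℝ) ^ (-(n : ℝ)) ≤ 1 / (4 * (b * ((q ^ n : ℕ) : ℝ))) := by
        have e1 := hqbig.trans (Real.rpow_le_rpow (by positivity) hb
          (show (0 : ℝ) ≤ (n : ℝ) - 1 by linarith))
        rw [Real.rpow_sub hb0, Real.rpow_one, le_div_iff₀ hb0] at e1
        rw [Real.rpow_neg hb0.le, ← one_div, Nat.cast_pow]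
        exact one_div_le_one_div_of_le (by positivity) (by linarith)
      have h6 : 1 / ((b : ℝ) * ((q ^ n : ℕ) : ℝ)) = 4 * (1 / (4 * (b * ((q ^ n : ℕ) : ℝ)))) := by
        have : (((q ^ n : ℕ)) : ℝ) ≠ 0 := by positivity
        field_simp
      have h7 : 0 < 1 / (4 * (b * ((q ^ n : ℕ) : ℝ))) := by positivity
      have t1 := abs_sub_le ((a : ℝ) / b) x ((P : ℝ) / ((q ^ n : ℕ) : ℝ))
      rw [abs_sub_comm ((a : ℝ) / b) x] at t1
      linarith

theorem dimH_exactOrder_rpow_le {τ τ₂ A : ℝ} (hτ : 0 < τ) (hτ₂ : 0 < τ₂) (hA : 0 ≤ A) :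
    dimH (exactOrder (fun q : ℝ => q ^ (-τ)) (fun q : ℝ => A * q ^ (-τ₂))) ≤
      ENNReal.ofReal (2 / (τ + τ₂)) := by
  refine dimH_exactOrder_le hA (by linarith) ?_
  filter_upwards [eventually_ge_atTop 1] with q hq
  have hq1 : (1 : ℝ) ≤ q := by exact_mod_cast hq
  refine ⟨Real.rpow_le_one_of_one_le_of_nonpos hq1 (by linarith), ?_⟩
  rw [mul_assoc, ← Real.rpow_add (by linarith), neg_add_rev]

end ExactApprox

/-! ### Assembly of the four statements -/

theorem mainTheorem7 (τ₁ : ℝ) (hτ₁ : 2 < τ₁) :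
    (∀ τ₂ : ℝ, 0 < τ₂ → τ₂ < τ₁ * (τ₁ - 2) →
      dimH (ExactApprox.exactOrder (fun q : ℝ => q ^ (-τ₁)) (fun q : ℝ => q ^ (-τ₂)))
        = ENNReal.ofReal (2 / (τ₁ + τ₂))) ∧
    ((∃ n : ℕ, 3 ≤ n ∧ τ₁ = (n : ℝ)) →
      (∀ τ₂ : ℝ, 0 < τ₂ → τ₂ < τ₁ * (τ₁ - 1) →
        dimH (ExactApprox.exactOrder (fun q : ℝ => q ^ (-τ₁)) (fun q : ℝ => q ^ (-τ₂)))
          = ENNReal.ofReal (2 / (τ₁ + τ₂))) ∧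
      (∀ C : ℝ, (45 / 16 : ℝ) * (8 : ℝ) ^ τ₁ < C →
        dimH (ExactApprox.exactOrder (fun q : ℝ => q ^ (-τ₁))
            (fun q : ℝ => C * q ^ (-(τ₁ * (τ₁ - 1)))))
          = ENNReal.ofReal (2 / τ₁ ^ 2)) ∧
      (∀ c : ℝ, 0 < c → c < 1 →
        ExactApprox.exactOrder (fun q : ℝ => q ^ (-τ₁))
            (fun q : ℝ => c * q ^ (-(τ₁ * (τ₁ - 1)))) = ∅)) := by
  have hupper : ∀ τ₂ : ℝ, 0 < τ₂ →
      dimH (ExactApprox.exactOrder (fun q : ℝ => q ^ (-τ₁)) (fun q : ℝ => q ^ (-τ₂)))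
        ≤ ENNReal.ofReal (2 / (τ₁ + τ₂)) := fun τ₂ h0 => by
    simpa only [one_mul] using
      ExactApprox.dimH_exactOrder_rpow_le (show 0 < τ₁ by linarith) h0 zero_le_one
  refine ⟨fun τ₂ h0 h1 => le_antisymm (hupper τ₂ h0)
    (ExactApprox.le_dimH_exactOrder_rpow hτ₁ h0 h1), ?_⟩
  rintro ⟨n, hn, rfl⟩
  have hn' : (3 : ℝ) ≤ n := by exact_mod_cast hn
  refine ⟨fun τ₂ h0 h1 => le_antisymm (hupper τ₂ h0) ?_, fun C hC => ?_, fun c hc hc1 =>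
    ExactApprox.exactOrder_eq_empty (by omega) hc hc1⟩
  · rcases lt_or_ge τ₂ ((n : ℝ) * ((n : ℝ) - 2)) with h2 | h2
    · exact ExactApprox.le_dimH_exactOrder_rpow hτ₁ h0 h2
    have := ExactApprox.le_dimH_exactOrder_natCast hn one_pos (κ := 1 / 2) (by norm_num) h2 ?_
    · simpa only [one_mul] using this
    -- Since `n + τ₂ < n²`, the trimmed part is eventually at most half of the window, whence `κ = 1
    -- / 2`.
    have h3 : ∀ᶠ q : ℕ in atTop, 2 ≤ (q : ℝ) ^ ((n : ℝ) * n - (n + τ₂)) :=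
      ((tendsto_rpow_atTop (by linarith)).comp
        tendsto_natCast_atTop_atTop).eventually_ge_atTop _
    filter_upwards [h3, eventually_gt_atTop 0] with q hq hqpos
    have hq0 : (0 : ℝ) < q := by exact_mod_cast hqpos
    have h4 := mul_le_mul_of_nonneg_right hq (show 0 ≤ (q : ℝ) ^ (-((n : ℝ) * n)) by positivity)
    rw [← Real.rpow_add hq0, show (n : ℝ) * n - (n + τ₂) + -((n : ℝ) * n) = -(n + τ₂) by ring]
      at h4
    linarith
  · have hC1 : 1 < C := by
      have : (1 : ℝ) ≤ 8 ^ (n : ℝ) := Real.one_le_rpow (by norm_num) (by linarith)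
      linarith
    have hsum : (n : ℝ) ^ 2 = n + n * (n - 1) := by ring
    rw [hsum]
    refine le_antisymm (ExactApprox.dimH_exactOrder_rpow_le (by linarith) (by nlinarith)
      (by linarith)) ?_
    -- At the critical exponent window and trimmed part have the same order `q ^ (-n²)`, and exactly
    -- `(C - 1) * q ^ (-n²)` is left.
    refine ExactApprox.le_dimH_exactOrder_natCast hn (by linarith) (sub_pos.2 hC1)
      (by nlinarith) (Eventually.of_forall fun q => ?_)
    rw [show (n : ℝ) * n = n + n * (n - 1) by ring, sub_one_mul]
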